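/- Let $\Omega_s\subset\mathbb{R}^d$ be a nonempty bounded open set, $T>0$, $\Omega=\Omega_s\times(0,T)$, and let $\mathcal H^1_E(\Omega)$ be the space of $v\in \mathcal H^1(\Omega)$ (in all $d+1$ space-time variables) with $v=0$ on $\partial\Omega_s\times(0,T)$ and at $t=0$ (i.e. the $\mathcal H^1$-closure of the smooth functions that vanish near this part of the boundary). For $\boldsymbol\beta\in\mathbb{R}^d$ put $\nu=(|\boldsymbol\beta|^2+1)^{-1/2}$. For $\alpha>0$, $\gamma\ge 0$ and $f\in L^2(\Omega)$ let $u\in\mathcal H^1_E(\Omega)$ be the weak solution of $Lu\equiv u_t-\alpha\Delta u+\boldsymbol\beta\cdot\nabla u+\gamma u=f$ ($\nabla$, $\Delta$ act in $x$ only), that is, with $(\cdot,\cdot)$ and $\|\cdot\|$ the inner product and norm of $L^2(\Omega_s)$, $$B(u,v)\equiv\int_0^T (u_t,v)+\alpha(\nabla u,\nabla v)+(\boldsymbol\beta\cdot\nabla u,v)+\gamma(u,v)\,dt=\int_0^T(f,v)\,dt\quad\text{for all }v\in\mathcal H^1_E(\Omega).$$ Let $\mathcal T_h$ be a finite tessellation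 of $\overline\Omega$ into convex polytopes (for instance simplices) with pairwise disjoint interiors contained in $\Omega$, shape regular and quasiuniform of size $h>0$ with constant $\sigma>0$: every element has diameter at most $h$ and contains a ball of radius $h/\sigma$. Let $r>1$ be an integer and let $V_h\subset\mathcal H^1_E(\Omega)$ be the space of functions in $\mathcal H^1_E(\Omega)$ that are continuous on $\overline\Omega$ and on each element are polynomials in $(x,t)$ of degree at most $r$. For $\theta>0$ let $u_h\in V_h$ be a streamline-diffusion solution: $$B(u_h,v)+\int_0^T\big(Lu_h,\theta h^2\nu(\boldsymbol\beta\cdot\nabla v+v_t)\big)\,dt=\int_0^T\big(f,v+\theta h^2\nu(\boldsymbol\beta\cdot\nabla v+v_t)\big)\,dt\quad\text{for all }v\in V_h,$$ where $\Delta$ in $L$ is taken elementwise. Define $$|||w|||^2=\|w(T)\|^2+\int_0^T\alpha\|\nabla w\|^2+h^2\nu\|\boldsymbol\beta\cdot\nabla w+w_t\|^2+\gamma\|w\|^2\,dt .$$ Then for every bound $M$ there is $\theta_0>0$, depending only on $\Omega_s,T,r,\sigma,M$, such that for every $0<\theta\le\theta_0$ there is $C>0$, depending only on $\Omega_s,T,r,\sigma,M,\theta$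 (in particular not on $h$), such that for all $0<\alpha\le M$, $0\le\gamma\le M$, all $\boldsymbol\beta$, and all $h,\mathcal T_h,f,u,u_h$ as above, $$|||u-u_h|||^2\le C\inf_{\chi\in V_h}\left(|||u-\chi|||^2+\int_0^T (h^2\nu)^{-1}\|u-\chi\|^2+\alpha h^2\|\Delta(u-\chi)\|^2\,dt\right),$$ with $\Delta(u-\chi)$ taken elementwise. -/

import Mathlib

open MeasureTheory Set Filter Topology
open scoped ContDiff

noncomputable section

namespace StreamlineDiffusion

/-- Space-time points `(x, t)`, `x ∈ ℝᵈ`, `t ∈ ℝ`, with the product Lebesgue measure. -/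
abbrev SpaceTime (d : ℕ) : Type := EuclideanSpace ℝ (Fin d) × ℝ

/-- The `i`-th spatial coordinate direction in space-time. -/
def ex {d : ℕ} (i : Fin d) : SpaceTime d := (EuclideanSpace.single i 1, 0)

/-- The time direction in space-time. -/
def et {d : ℕ} : SpaceTime d := (0, 1)

/-- The space-time domain `Ω = Ωs × (0, T)`. -/
def cyl {d : ℕ} (Ωs : Set (EuclideanSpace ℝ (Fin d))) (T : ℝ) : Set (SpaceTime d) :=
  Ωs ×ˢ Ioo 0 T

/-- The part of the boundary that carries the Dirichlet and initial conditions: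
the lateral boundary and the bottom `t = 0`. -/
def dirichletBdry {d : ℕ} (Ωs : Set (EuclideanSpace ℝ (Fin d))) (T : ℝ) : Set (SpaceTime d) :=
  (frontier Ωs ×ˢ Icc 0 T) ∪ (closure Ωs ×ˢ {0})

/-- Test functions `C_c^∞(U)`. -/
def IsTest {d : ℕ} (U : Set (SpaceTime d)) (φ : SpaceTime d → ℝ) : Prop :=
  ContDiff ℝ ∞ φ ∧ HasCompactSupport φ ∧ tsupport φ ⊆ U

/-- `g` is an `L²(U)` weak derivative of `w` on `U` in the direction `e`. -/
def HasWeakDeriv {d : ℕ} (U : Set (SpaceTime d)) (e : SpaceTime d) (w g : SpaceTime d → ℝ) :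
    Prop :=
  MemLp g 2 (volume.restrict U) ∧
    ∀ φ, IsTest U φ → ∫ p in U, w p * fderiv ℝ φ p e = - ∫ p in U, g p * φ p

open Classical in
/-- The weak derivative of `w` on `U` in the direction `e` (a representative of it; it is unique
almost everywhere on the open set `U`). -/
def weakDeriv {d : ℕ} (U : Set (SpaceTime d)) (e : SpaceTime d) (w : SpaceTime d → ℝ) :
    SpaceTime d → ℝ :=
  if hw : ∃ g, HasWeakDeriv U e w g then hw.choose else 0

/-- The Sobolev space `H¹(U)` in the space and time variables. -/
def MemH1 {d : ℕ} (U : Set (SpaceTime d)) (w : SpaceTime d → ℝ) : Prop :=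
  MemLp w 2 (volume.restrict U) ∧ (∀ i : Fin d, ∃ g, HasWeakDeriv U (ex i) w g) ∧
    ∃ g, HasWeakDeriv U et w g

/-- Smooth functions vanishing near the lateral boundary and near the bottom of the cylinder. -/
def IsSmoothE {d : ℕ} (Ωs : Set (EuclideanSpace ℝ (Fin d))) (T : ℝ) (φ : SpaceTime d → ℝ) :
    Prop :=
  ContDiff ℝ ∞ φ ∧ ∀ p ∈ dirichletBdry Ωs T, φ =ᶠ[𝓝 p] 0

/-- The sequence of smooth functions `φ n` converges to `w` in `H¹(U)`. -/
def TendstoH1 {d : ℕ} (U : Set (SpaceTime d)) (φ : ℕ → SpaceTime d → ℝ) (w : SpaceTime d → ℝ) :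
    Prop :=
  Tendsto (fun n => eLpNorm (fun p => φ n p - w p) 2 (volume.restrict U)) atTop (𝓝 0) ∧
  (∀ i : Fin d, Tendsto (fun n => eLpNorm
      (fun p => fderiv ℝ (φ n) p (ex i) - weakDeriv U (ex i) w p) 2 (volume.restrict U))
      atTop (𝓝 0)) ∧
  Tendsto (fun n => eLpNorm
      (fun p => fderiv ℝ (φ n) p et - weakDeriv U et w p) 2 (volume.restrict U))
      atTop (𝓝 0)

/-- The space `H¹_E(Ω)` of `H¹` functions with `w = 0` on the lateral boundary and at `t = 0`:
the closure in `H¹(Ω)` of the smooth functions that vanish near that part of the boundary. -/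
def MemH1E {d : ℕ} (Ωs : Set (EuclideanSpace ℝ (Fin d))) (T : ℝ) (w : SpaceTime d → ℝ) : Prop :=
  MemH1 (cyl Ωs T) w ∧
    ∃ φ : ℕ → SpaceTime d → ℝ, (∀ n, IsSmoothE Ωs T (φ n)) ∧ TendstoH1 (cyl Ωs T) φ w

/-- `g ∈ L²(Ωs)` is the trace `w(T)` of `w ∈ H¹_E(Ω)` at the final time: the `L²(Ωs)` limit of the
final values of smooth functions approximating `w` in `H¹_E(Ω)`. -/
def IsFinalTrace {d : ℕ} (Ωs : Set (EuclideanSpace ℝ (Fin d))) (T : ℝ) (w : SpaceTime d → ℝ)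
    (g : EuclideanSpace ℝ (Fin d) → ℝ) : Prop :=
  MemLp g 2 (volume.restrict Ωs) ∧
    ∃ φ : ℕ → SpaceTime d → ℝ, (∀ n, IsSmoothE Ωs T (φ n)) ∧ TendstoH1 (cyl Ωs T) φ w ∧
      Tendsto (fun n => eLpNorm (fun x => φ n (x, T) - g x) 2 (volume.restrict Ωs)) atTop (𝓝 0)

open Classical in
/-- The final-time trace `w(T)`, for `w ∈ H¹_E(Ω)`. -/
def finalTrace {d : ℕ} (Ωs : Set (EuclideanSpace ℝ (Fin d))) (T : ℝ) (w : SpaceTime d → ℝ) :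
    EuclideanSpace ℝ (Fin d) → ℝ :=
  if hw : ∃ g, IsFinalTrace Ωs T w g then hw.choose else 0

/-- A tessellation `𝒯` of the closed cylinder into finitely many convex polytopes (for instance
simplices) with disjoint interiors, shape regular and quasiuniform of size `h` with constant `σ`:
every element has Euclidean diameter at most `h` and contains a Euclidean ball of radius `h / σ`.
No face-to-face condition is imposed. -/
structure IsTessellation {d : ℕ} (Ωs : Set (EuclideanSpace ℝ (Fin d))) (T σ h : ℝ)
    (𝒯 : Set (Set (SpaceTime d))) : Prop where
  finite : 𝒯.Finite
  polytope : ∀ K ∈ 𝒯, ∃ s : Finset (SpaceTime d), K = convexHull ℝ (s : Set (SpaceTime d))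
  interior_subset : ∀ K ∈ 𝒯, interior K ⊆ cyl Ωs T
  disjoint : ∀ K ∈ 𝒯, ∀ K' ∈ 𝒯, K ≠ K' → Disjoint (interior K) (interior K')
  cover : ⋃₀ 𝒯 = closure (cyl Ωs T)
  size : ∀ K ∈ 𝒯, ∀ p ∈ K, ∀ q ∈ K, ‖p.1 - q.1‖ ^ 2 + (p.2 - q.2) ^ 2 ≤ h ^ 2
  shape : ∀ K ∈ 𝒯, ∃ c : SpaceTime d,
    {q : SpaceTime d | ‖q.1 - c.1‖ ^ 2 + (q.2 - c.2) ^ 2 < (h / σ) ^ 2} ⊆ K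

/-- The finite element space `V_h ⊂ H¹_E(Ω)`: continuous functions on the closed cylinder that
belong to `H¹_E(Ω)` and are, on each element, a polynomial in `(x, t)` of total degree at
most `r`. -/
def FESpace {d : ℕ} (Ωs : Set (EuclideanSpace ℝ (Fin d))) (T : ℝ) (𝒯 : Set (Set (SpaceTime d)))
    (r : ℕ) : Set (SpaceTime d → ℝ) :=
  {v | ContinuousOn v (closure (cyl Ωs T)) ∧ MemH1E Ωs T v ∧
    ∀ K ∈ 𝒯, ∃ P : MvPolynomial (Fin d ⊕ Unit) ℝ, P.totalDegree ≤ r ∧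
      ∀ p ∈ K, v p = MvPolynomial.eval (Sum.elim (fun i => p.1 i) (fun _ => p.2)) P}

/-- The spatial Laplacian of a smooth function of `(x, t)`. -/
def spatialLaplacian {d : ℕ} (φ : SpaceTime d → ℝ) (p : SpaceTime d) : ℝ :=
  ∑ i : Fin d, fderiv ℝ (fun q => fderiv ℝ φ q (ex i)) p (ex i)

/-- `l ∈ L²(Ω)` is the elementwise (weak) spatial Laplacian of `w`. -/
def IsBrokenLaplacian {d : ℕ} (Ωs : Set (EuclideanSpace ℝ (Fin d))) (T : ℝ)
    (𝒯 : Set (Set (SpaceTime d))) (w l : SpaceTime d → ℝ) : Prop :=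
  MemLp l 2 (volume.restrict (cyl Ωs T)) ∧
    ∀ K ∈ 𝒯, ∀ φ, IsTest (interior K) φ →
      ∫ p in K, w p * spatialLaplacian φ p = ∫ p in K, l p * φ p

open Classical in
/-- The elementwise spatial Laplacian `Δw` of `w`. -/
def brokenLaplacian {d : ℕ} (Ωs : Set (EuclideanSpace ℝ (Fin d))) (T : ℝ)
    (𝒯 : Set (Set (SpaceTime d))) (w : SpaceTime d → ℝ) : SpaceTime d → ℝ :=
  if hw : ∃ l, IsBrokenLaplacian Ωs T 𝒯 w l then hw.choose else 0

/-- The streamline derivative `w_t + β · ∇w`. -/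
def streamDeriv {d : ℕ} (Ωs : Set (EuclideanSpace ℝ (Fin d))) (T : ℝ)
    (β : EuclideanSpace ℝ (Fin d)) (w : SpaceTime d → ℝ) (p : SpaceTime d) : ℝ :=
  weakDeriv (cyl Ωs T) et w p + ∑ i : Fin d, β i * weakDeriv (cyl Ωs T) (ex i) w p

/-- `ν = 1 / √(|β|² + 1)`. -/
def nu {d : ℕ} (β : EuclideanSpace ℝ (Fin d)) : ℝ := 1 / Real.sqrt (‖β‖ ^ 2 + 1)

/-- The space-time bilinear form
`B(u, v) = ∫₀ᵀ (u_t, v) + α (∇u, ∇v) + (β · ∇u, v) + γ (u, v) dt`. -/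
def formB {d : ℕ} (Ωs : Set (EuclideanSpace ℝ (Fin d))) (T α : ℝ)
    (β : EuclideanSpace ℝ (Fin d)) (γ : ℝ) (u v : SpaceTime d → ℝ) : ℝ :=
  ∫ p in cyl Ωs T, (streamDeriv Ωs T β u p * v p
    + α * ∑ i : Fin d, weakDeriv (cyl Ωs T) (ex i) u p * weakDeriv (cyl Ωs T) (ex i) v p
    + γ * (u p * v p))

/-- The operator `Lw = w_t - α Δw + β · ∇w + γ w`, with `Δ` understood elementwise. -/
def opL {d : ℕ} (Ωs : Set (EuclideanSpace ℝ (Fin d))) (T : ℝ) (𝒯 : Set (Set (SpaceTime d)))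
    (α : ℝ) (β : EuclideanSpace ℝ (Fin d)) (γ : ℝ) (w : SpaceTime d → ℝ) (p : SpaceTime d) : ℝ :=
  streamDeriv Ωs T β w p - α * brokenLaplacian Ωs T 𝒯 w p + γ * w p

/-- The weak solution `u ∈ H¹_E(Ω)` of
`u_t - α Δu + β · ∇u + γ u = f`, `u = 0` on the lateral boundary and at `t = 0`. -/
def IsWeakSolution {d : ℕ} (Ωs : Set (EuclideanSpace ℝ (Fin d))) (T α : ℝ)
    (β : EuclideanSpace ℝ (Fin d)) (γ : ℝ) (f u : SpaceTime d → ℝ) : Prop :=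
  MemH1E Ωs T u ∧ ∀ v, MemH1E Ωs T v → formB Ωs T α β γ u v = ∫ p in cyl Ωs T, f p * v p

/-- The streamline-diffusion solution `u_h ∈ V_h` with stabilization weight `θ h² ν`. -/
def IsDiscreteSolution {d : ℕ} (Ωs : Set (EuclideanSpace ℝ (Fin d))) (T : ℝ)
    (𝒯 : Set (Set (SpaceTime d))) (r : ℕ) (h θ α : ℝ) (β : EuclideanSpace ℝ (Fin d)) (γ : ℝ)
    (f uh : SpaceTime d → ℝ) : Prop :=
  uh ∈ FESpace Ωs T 𝒯 r ∧ ∀ v ∈ FESpace Ωs T 𝒯 r,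
    formB Ωs T α β γ uh v
      + ∫ p in cyl Ωs T, opL Ωs T 𝒯 α β γ uh p * (θ * h ^ 2 * nu β * streamDeriv Ωs T β v p)
    = ∫ p in cyl Ωs T, f p * (v p + θ * h ^ 2 * nu β * streamDeriv Ωs T β v p)

/-- The square of the energy norm, with stabilization weight `h² ν`:
`‖w(T)‖² + ∫₀ᵀ α ‖∇w‖² + h² ν ‖β · ∇w + w_t‖² + γ ‖w‖² dt`. -/
def energySq {d : ℕ} (Ωs : Set (EuclideanSpace ℝ (Fin d))) (T h α : ℝ)
    (β : EuclideanSpace ℝ (Fin d)) (γ : ℝ) (w : SpaceTime d → ℝ) : ℝ :=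
  (∫ x in Ωs, finalTrace Ωs T w x ^ 2)
    + ∫ p in cyl Ωs T, (α * ∑ i : Fin d, weakDeriv (cyl Ωs T) (ex i) w p ^ 2
        + h ^ 2 * nu β * streamDeriv Ωs T β w p ^ 2 + γ * w p ^ 2)

end StreamlineDiffusion

end

namespace StreamlineDiffusion

variable {d : ℕ}

/-! Write δ = h²ν, D = ∂_t + β·∇, η = u − χ and ξ = χ − u_h, so that the error is η + ξ. Three facts
carry the estimate.

Energy identity: 2(Dw, w) = ‖w(T)‖² for w in H¹_E, since β is constant and w vanishes on the lateral
boundary and at t = 0 (`MemH1E.integral_finalTrace_sq`). It is proved for smooth functions and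
passed to the limit. The final-time term of the energy thus becomes an inner product over the
cylinder, and after that the traces enter only through positivity of (Dw, w).

Consistency: the weak equation shows that the elementwise Laplacian of u is in L² and that Lu = f
there (`IsWeakSolution.isBrokenLaplacian`, `IsWeakSolution.load_eq`). Testing both problems with ξ
gives Galerkin orthogonality for the stabilized form.

Inverse estimate: h²‖Δξ‖² ≤ C‖∇ξ‖² on the finite element space, with C depending only on d, r and σ
(`exists_inverse_estimate_FESpace`). It allows the stabilization term αθδ(Δξ, Dξ) to be absorbed
when θ is small.

`stream_stability` combines these in abstract Hilbert spaces. Orthogonality leaves the term −(Dη,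
ξ), in which D must move onto ξ. Positivity of (Dw, w) at w = 2η + ξ does this, at the cost of 2(Dη,
η) + ½(Dξ, ξ). The resulting (Dξ, η) is split by Young's inequality into θδ‖Dξ‖² and δ⁻¹‖η‖², which
is the source of the weight (h²ν)⁻¹. All remaining terms are handled by Young's inequality and
absorption. -/

instance : (volume : Measure (SpaceTime d)).IsAddHaarMeasure :=
  inferInstanceAs ((volume : Measure (EuclideanSpace ℝ (Fin d))).prod volume).IsAddHaarMeasure

/-! ### Test functions and weak derivatives -/

section WeakDerivatives

variable {U V : Set (SpaceTime d)} {e : SpaceTime d} {w v g g' φ : SpaceTime d → ℝ}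

lemma contDiff_dirDeriv (hφ : ContDiff ℝ ∞ φ) (e : SpaceTime d) :
    ContDiff ℝ ∞ (fun p => fderiv ℝ φ p e) :=
  (hφ.fderiv_right (m := ∞) (by simp)).clm_apply contDiff_const

lemma tsupport_dirDeriv_subset (φ : SpaceTime d → ℝ) (e : SpaceTime d) :
    tsupport (fun p => fderiv ℝ φ p e) ⊆ tsupport φ :=
  tsupport_fderiv_apply_subset ℝ e

lemma IsTest.dirDeriv (hφ : IsTest U φ) (e : SpaceTime d) :
    IsTest U (fun p => fderiv ℝ φ p e) :=
  ⟨contDiff_dirDeriv hφ.1 e, hφ.2.1.mono' (subset_closure.trans (tsupport_dirDeriv_subset φ e)),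
    (tsupport_dirDeriv_subset φ e).trans hφ.2.2⟩

lemma IsTest.mono (hφ : IsTest U φ) (h : U ⊆ V) : IsTest V φ :=
  ⟨hφ.1, hφ.2.1, hφ.2.2.trans h⟩

lemma IsTest.memLp (hφ : IsTest U φ) (μ : Measure (SpaceTime d))
    [IsFiniteMeasureOnCompacts μ] : MemLp φ 2 μ :=
  hφ.1.continuous.memLp_of_hasCompactSupport hφ.2.1

lemma IsTest.eq_zero_of_notMem (hφ : IsTest U φ) {p : SpaceTime d} (hp : p ∉ U) : φ p = 0 :=
  image_eq_zero_of_notMem_tsupport fun h => hp (hφ.2.2 h)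

lemma IsTest.setIntegral_mul_eq (hφ : IsTest U φ) (hUV : U ⊆ V) (g : SpaceTime d → ℝ) :
    ∫ p in V, g p * φ p = ∫ p in U, g p * φ p := by
  rw [setIntegral_eq_integral_of_forall_compl_eq_zero,
    setIntegral_eq_integral_of_forall_compl_eq_zero]
  · intro p hp; rw [hφ.eq_zero_of_notMem hp, mul_zero]
  · intro p hp; rw [hφ.eq_zero_of_notMem fun h => hp (hUV h), mul_zero]

lemma integrable_mul_of_memLp {μ : Measure (SpaceTime d)} (hv : MemLp v 2 μ) (hw : MemLp w 2 μ) :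
    Integrable (fun p => v p * w p) μ :=
  hv.integrable_mul hw

/-- The fundamental lemma of the calculus of variations. Weak derivatives and elementwise Laplacians
are selected by choice, so every computation with them rests on this uniqueness. -/
lemma ae_eq_of_forall_test (hU : IsOpen U) (hg : MemLp g 2 (volume.restrict U))
    (hg' : MemLp g' 2 (volume.restrict U))
    (h : ∀ φ, IsTest U φ → ∫ p in U, g p * φ p = ∫ p in U, g' p * φ p) :
    g =ᵐ[volume.restrict U] g' := by
  have hloc : LocallyIntegrableOn (fun p => g p - g' p) U (volume : Measure (SpaceTime d)) := by
    rw [locallyIntegrableOn_iff hU.isLocallyClosed]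
    intro k hk hkc
    have hm : MemLp (fun p => g p - g' p) 2 (volume.restrict k) :=
      (hg.sub hg').mono_measure (Measure.restrict_mono hk le_rfl)
    have : IsFiniteMeasure (volume.restrict k : Measure (SpaceTime d)) :=
      ⟨by simpa using hkc.measure_lt_top⟩
    exact hm.integrable (by norm_num)
  have := hU.ae_eq_zero_of_integral_contDiff_smul_eq_zero hloc (fun φ h1 h2 h3 => by
    have hφ : IsTest U φ := ⟨h1, h2, h3⟩
    have h4 := h φ hφ
    rw [← setIntegral_eq_integral_of_forall_compl_eq_zero (s := U) (fun p hp => by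
      rw [hφ.eq_zero_of_notMem hp, zero_smul])]
    simp only [smul_eq_mul]
    rw [← sub_eq_zero, ← integral_sub (integrable_mul_of_memLp hg (hφ.memLp _))
      (integrable_mul_of_memLp hg' (hφ.memLp _))] at h4
    rw [← h4]
    exact integral_congr_ae (Eventually.of_forall fun p => by ring))
  rw [Filter.EventuallyEq, ae_restrict_iff' hU.measurableSet]
  filter_upwards [this] with p hp hpU
  linarith [hp hpU]

lemma HasWeakDeriv.ae_eq (hU : IsOpen U) (h : HasWeakDeriv U e w g) (h' : HasWeakDeriv U e w g') :
    g =ᵐ[volume.restrict U] g' :=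
  ae_eq_of_forall_test hU h.1 h'.1 fun φ hφ => by
    have h1 := h.2 φ hφ
    have h2 := h'.2 φ hφ
    linarith

lemma HasWeakDeriv.weakDeriv (h : HasWeakDeriv U e w g) :
    HasWeakDeriv U e w (weakDeriv U e w) := by
  have h' : ∃ g, HasWeakDeriv U e w g := ⟨g, h⟩
  rw [StreamlineDiffusion.weakDeriv, dif_pos h']
  exact h'.choose_spec

lemma HasWeakDeriv.weakDeriv_ae_eq (hU : IsOpen U) (h : HasWeakDeriv U e w g) :
    StreamlineDiffusion.weakDeriv U e w =ᵐ[volume.restrict U] g :=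
  h.weakDeriv.ae_eq hU h

lemma HasWeakDeriv.sub (hw : MemLp w 2 (volume.restrict U)) (hv : MemLp v 2 (volume.restrict U))
    (h : HasWeakDeriv U e w g) (h' : HasWeakDeriv U e v g') :
    HasWeakDeriv U e (fun p => w p - v p) (fun p => g p - g' p) := by
  refine ⟨h.1.sub h'.1, fun φ hφ => ?_⟩
  simp only [sub_mul]
  rw [integral_sub (integrable_mul_of_memLp hw ((hφ.dirDeriv e).memLp _))
      (integrable_mul_of_memLp hv ((hφ.dirDeriv e).memLp _)),
    integral_sub (integrable_mul_of_memLp h.1 (hφ.memLp _))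
      (integrable_mul_of_memLp h'.1 (hφ.memLp _)), h.2 φ hφ, h'.2 φ hφ]
  ring

lemma HasWeakDeriv.mono (hVU : V ⊆ U) (h : HasWeakDeriv U e w g) : HasWeakDeriv V e w g := by
  refine ⟨h.1.mono_measure (Measure.restrict_mono hVU le_rfl), fun φ hφ => ?_⟩
  rw [← (hφ.dirDeriv e).setIntegral_mul_eq hVU, ← hφ.setIntegral_mul_eq hVU]
  exact h.2 φ (hφ.mono hVU)

lemma HasWeakDeriv.congr (h : HasWeakDeriv U e w g) (hw : w =ᵐ[volume.restrict U] v) :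
    HasWeakDeriv U e v g := by
  refine ⟨h.1, fun φ hφ => ?_⟩
  rw [← h.2 φ hφ]
  refine integral_congr_ae ?_
  filter_upwards [hw] with p hp
  rw [hp]

/-- Integration by parts against a test function. -/
lemma integral_mul_dirDeriv_test {φ ψ : SpaceTime d → ℝ} (hψ : ContDiff ℝ ∞ ψ) (hφ : IsTest U φ)
    (e : SpaceTime d) :
    ∫ p in U, ψ p * fderiv ℝ φ p e = - ∫ p in U, fderiv ℝ ψ p e * φ p := by
  rw [← (hφ.dirDeriv e).setIntegral_mul_eq (subset_univ U),
    ← hφ.setIntegral_mul_eq (subset_univ U), Measure.restrict_univ]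
  refine integral_mul_fderiv_eq_neg_fderiv_mul_of_integrable ?_ ?_ ?_
    (fun x _ => hψ.differentiable (by simp) x) (fun x _ => hφ.1.differentiable (by simp) x)
  · exact ((contDiff_dirDeriv hψ e).continuous.mul hφ.1.continuous).integrable_of_hasCompactSupport
      hφ.2.1.mul_left
  · exact (hψ.continuous.mul (hφ.dirDeriv e).1.continuous).integrable_of_hasCompactSupport
      (hφ.dirDeriv e).2.1.mul_left
  · exact (hψ.continuous.mul hφ.1.continuous).integrable_of_hasCompactSupport hφ.2.1.mul_left

lemma memLp_of_continuous (hU : Bornology.IsBounded U) (hφ : Continuous φ) :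
    MemLp φ 2 (volume.restrict U) := by
  have hc : IsCompact (closure U) := hU.isCompact_closure
  have : IsFiniteMeasure (volume.restrict (closure U) : Measure (SpaceTime d)) :=
    ⟨by simpa using hc.measure_lt_top⟩
  obtain ⟨C, hC⟩ := hc.exists_bound_of_continuousOn hφ.continuousOn
  exact (MemLp.of_bound hφ.aestronglyMeasurable C
    ((ae_restrict_iff' isClosed_closure.measurableSet).2 (Eventually.of_forall hC))).mono_measure
    (Measure.restrict_mono subset_closure le_rfl)

lemma hasWeakDeriv_of_contDiff (hU : Bornology.IsBounded U) (hφ : ContDiff ℝ ∞ φ)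
    (e : SpaceTime d) : HasWeakDeriv U e φ (fun p => fderiv ℝ φ p e) :=
  ⟨memLp_of_continuous hU (contDiff_dirDeriv hφ e).continuous,
    fun _ hψ => integral_mul_dirDeriv_test hφ hψ e⟩

lemma MemH1.hasWeakDeriv_ex (h : MemH1 U w) (i : Fin d) :
    HasWeakDeriv U (ex i) w (weakDeriv U (ex i) w) :=
  (h.2.1 i).choose_spec.weakDeriv

lemma MemH1.hasWeakDeriv_et (h : MemH1 U w) : HasWeakDeriv U et w (weakDeriv U et w) :=
  h.2.2.choose_spec.weakDeriv

lemma MemH1.sub (h : MemH1 U w) (h' : MemH1 U v) : MemH1 U (fun p => w p - v p) :=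
  ⟨h.1.sub h'.1, fun i => ⟨_, (h.hasWeakDeriv_ex i).sub h.1 h'.1 (h'.hasWeakDeriv_ex i)⟩,
    ⟨_, h.hasWeakDeriv_et.sub h.1 h'.1 h'.hasWeakDeriv_et⟩⟩

lemma MemH1.weakDeriv_ex_sub (hU : IsOpen U) (h : MemH1 U w) (h' : MemH1 U v) (i : Fin d) :
    weakDeriv U (ex i) (fun p => w p - v p) =ᵐ[volume.restrict U]
      fun p => weakDeriv U (ex i) w p - weakDeriv U (ex i) v p :=
  ((h.hasWeakDeriv_ex i).sub h.1 h'.1 (h'.hasWeakDeriv_ex i)).weakDeriv_ae_eq hU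

lemma MemH1.weakDeriv_et_sub (hU : IsOpen U) (h : MemH1 U w) (h' : MemH1 U v) :
    weakDeriv U et (fun p => w p - v p) =ᵐ[volume.restrict U]
      fun p => weakDeriv U et w p - weakDeriv U et v p :=
  (h.hasWeakDeriv_et.sub h.1 h'.1 h'.hasWeakDeriv_et).weakDeriv_ae_eq hU

lemma memH1_of_contDiff (hU : Bornology.IsBounded U) (hφ : ContDiff ℝ ∞ φ) : MemH1 U φ :=
  ⟨memLp_of_continuous hU hφ.continuous, fun i => ⟨_, hasWeakDeriv_of_contDiff hU hφ (ex i)⟩,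
    ⟨_, hasWeakDeriv_of_contDiff hU hφ et⟩⟩

end WeakDerivatives

/-! ### The space `H¹_E` -/

section EnergySpace

variable {Ωs : Set (EuclideanSpace ℝ (Fin d))} {T : ℝ} {w v φ ψ : SpaceTime d → ℝ}

lemma isOpen_cyl (hΩ : IsOpen Ωs) (T : ℝ) : IsOpen (cyl Ωs T) := hΩ.prod isOpen_Ioo

lemma isBounded_cyl (hΩ : Bornology.IsBounded Ωs) (T : ℝ) : Bornology.IsBounded (cyl Ωs T) :=
  hΩ.prod (Metric.isBounded_Ioo 0 T)

lemma IsSmoothE.sub (hφ : IsSmoothE Ωs T φ) (hψ : IsSmoothE Ωs T ψ) :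
    IsSmoothE Ωs T (fun p => φ p - ψ p) :=
  ⟨hφ.1.sub hψ.1, fun p hp => by
    filter_upwards [hφ.2 p hp, hψ.2 p hp] with q h1 h2
    simp [h1, h2]⟩

/-- The limit `F` is fixed only almost everywhere because the chosen weak derivative of a difference
agrees only almost everywhere with the difference of the chosen ones. -/
lemma tendsto_eLpNorm_sub {μ : Measure (SpaceTime d)} {a b : ℕ → SpaceTime d → ℝ}
    {f g F : SpaceTime d → ℝ} (ha : ∀ n, AEStronglyMeasurable (a n) μ)
    (hb : ∀ n, AEStronglyMeasurable (b n) μ) (hf : AEStronglyMeasurable f μ)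
    (hg : AEStronglyMeasurable g μ) (hF : F =ᵐ[μ] fun p => f p - g p)
    (h1 : Tendsto (fun n => eLpNorm (fun p => a n p - f p) 2 μ) atTop (𝓝 0))
    (h2 : Tendsto (fun n => eLpNorm (fun p => b n p - g p) 2 μ) atTop (𝓝 0)) :
    Tendsto (fun n => eLpNorm (fun p => (a n p - b n p) - F p) 2 μ) atTop (𝓝 0) := by
  refine tendsto_of_tendsto_of_tendsto_of_le_of_le tendsto_const_nhds
    (by simpa using h1.add h2) (fun _ => zero_le) fun n => ?_
  refine le_trans (le_of_eq (eLpNorm_congr_ae ?_))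
    (eLpNorm_sub_le ((ha n).sub hf) ((hb n).sub hg) (by norm_num))
  filter_upwards [hF] with p hp
  simp [hp]; ring

lemma MemH1E.sub (hΩo : IsOpen Ωs) (hw : MemH1E Ωs T w) (hv : MemH1E Ωs T v) :
    MemH1E Ωs T (fun p => w p - v p) := by
  obtain ⟨hw1, φ, hφ, hφ1, hφ2, hφ3⟩ := hw
  obtain ⟨hv1, ψ, hψ, hψ1, hψ2, hψ3⟩ := hv
  have hU := isOpen_cyl hΩo T
  have hd : ∀ (φ : ℕ → SpaceTime d → ℝ), (∀ n, IsSmoothE Ωs T (φ n)) → ∀ e n,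
      AEStronglyMeasurable (fun p => fderiv ℝ (φ n) p e) (volume.restrict (cyl Ωs T)) :=
    fun φ hφ e n => (contDiff_dirDeriv (hφ n).1 e).continuous.aestronglyMeasurable
  have hfd : ∀ n p e, fderiv ℝ (fun p => φ n p - ψ n p) p e
      = fderiv ℝ (φ n) p e - fderiv ℝ (ψ n) p e := fun n p e => by
    rw [fderiv_fun_sub ((hφ n).1.differentiable (by simp) p)
      ((hψ n).1.differentiable (by simp) p)]
    rfl
  refine ⟨hw1.sub hv1, fun n p => φ n p - ψ n p, fun n => (hφ n).sub (hψ n), ?_, fun i => ?_, ?_⟩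
  · exact tendsto_eLpNorm_sub (fun n => (hφ n).1.continuous.aestronglyMeasurable)
      (fun n => (hψ n).1.continuous.aestronglyMeasurable) hw1.1.1 hv1.1.1 (by rfl) hφ1 hψ1
  · simp only [hfd]
    exact tendsto_eLpNorm_sub (hd φ hφ _) (hd ψ hψ _) (hw1.hasWeakDeriv_ex i).1.1
      (hv1.hasWeakDeriv_ex i).1.1 (hw1.weakDeriv_ex_sub hU hv1 i) (hφ2 i) (hψ2 i)
  · simp only [hfd]
    exact tendsto_eLpNorm_sub (hd φ hφ _) (hd ψ hψ _) hw1.hasWeakDeriv_et.1.1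
      hv1.hasWeakDeriv_et.1.1 (hw1.weakDeriv_et_sub hU hv1) hφ3 hψ3

lemma IsSmoothE.memH1E (hΩo : IsOpen Ωs) (hΩb : Bornology.IsBounded Ωs)
    (hφ : IsSmoothE Ωs T φ) : MemH1E Ωs T φ := by
  have hU := isOpen_cyl hΩo T
  have hb := isBounded_cyl hΩb T
  have key : ∀ e, eLpNorm (fun p => fderiv ℝ φ p e - weakDeriv (cyl Ωs T) e φ p) 2
      (volume.restrict (cyl Ωs T)) = 0 := fun e => by
    rw [eLpNorm_congr_ae (g := 0), eLpNorm_zero]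
    filter_upwards [(hasWeakDeriv_of_contDiff hb hφ.1 e).weakDeriv_ae_eq hU] with p hp
    simp [hp]
  refine ⟨memH1_of_contDiff hb hφ.1, fun _ => φ, fun _ => hφ, ?_, fun i => ?_, ?_⟩
  · simp
  · simp only [key]; exact tendsto_const_nhds
  · simp only [key]; exact tendsto_const_nhds

lemma dirichletBdry_disjoint_cyl (hΩo : IsOpen Ωs) {p : SpaceTime d}
    (hp : p ∈ dirichletBdry Ωs T) : p ∉ cyl Ωs T := by
  rintro ⟨h1, h2⟩
  rcases hp with ⟨h, -⟩ | ⟨-, h⟩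
  · exact (hΩo.frontier_eq ▸ h).2 h1
  · rw [mem_singleton_iff] at h
    exact absurd h2.1 (by simp [h])

lemma IsTest.isSmoothE (hΩo : IsOpen Ωs) (hφ : IsTest (cyl Ωs T) φ) : IsSmoothE Ωs T φ :=
  ⟨hφ.1, fun _ hp => notMem_tsupport_iff_eventuallyEq.1
    fun h => dirichletBdry_disjoint_cyl hΩo hp (hφ.2.2 h)⟩

end EnergySpace

end StreamlineDiffusion
namespace StreamlineDiffusion

variable {d : ℕ} {Ωs : Set (EuclideanSpace ℝ (Fin d))} {T : ℝ} {φ ψ : SpaceTime d → ℝ}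

/-! ### Integration over the cylinder -/

lemma IsSmoothE.mul_self (hφ : IsSmoothE Ωs T φ) : IsSmoothE Ωs T (fun p => φ p * φ p) :=
  ⟨hφ.1.mul hφ.1, fun p hp => by
    filter_upwards [hφ.2 p hp] with q h1
    simp [h1]⟩

lemma integral_fderiv_eq_zero_of_hasCompactSupport {E : Type*} [NormedAddCommGroup E]
    [NormedSpace ℝ E] [MeasurableSpace E] [BorelSpace E] [FiniteDimensional ℝ E] {μ : Measure E}
    [μ.IsAddHaarMeasure] {G : E → ℝ} (hG : ContDiff ℝ ∞ G) (hc : HasCompactSupport G) (e : E) :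
    ∫ x, fderiv ℝ G x e ∂μ = 0 := by
  have h1 : Continuous (fun x => fderiv ℝ G x e) :=
    ((hG.fderiv_right (m := ∞) (by simp)).clm_apply contDiff_const).continuous
  have := integral_mul_fderiv_eq_neg_fderiv_mul_of_integrable (μ := μ) (f := fun _ : E => (1 : ℝ))
    (g := G) (v := e) (by simp)
    (by simpa using h1.integrable_of_hasCompactSupport (hc.fderiv_apply ℝ e))
    (by simpa using hG.continuous.integrable_of_hasCompactSupport hc)
    (fun _ _ => differentiableAt_const _) (fun x _ => hG.differentiable (by simp) x)
  simpa using this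

/-- Since `g` vanishes near the frontier, its extension by zero outside `s` is smooth with compact
support, and the whole-space result applies. No regularity of the boundary is needed. -/
lemma setIntegral_fderiv_eq_zero {E : Type*} [NormedAddCommGroup E]
    [NormedSpace ℝ E] [MeasurableSpace E] [BorelSpace E] [FiniteDimensional ℝ E] {μ : Measure E}
    [μ.IsAddHaarMeasure] {s : Set E} (hs : IsOpen s) (hb : Bornology.IsBounded s) {g : E → ℝ}
    (hg : ContDiff ℝ ∞ g) (h0 : ∀ x ∈ frontier s, g =ᶠ[𝓝 x] 0) (e : E) :
    ∫ x in s, fderiv ℝ g x e ∂μ = 0 := by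
  have hin : ∀ x ∈ s, s.indicator g =ᶠ[𝓝 x] g := fun x hx => by
    filter_upwards [hs.mem_nhds hx] with y hy
    rw [indicator_of_mem hy]
  have hout : ∀ x ∉ s, s.indicator g =ᶠ[𝓝 x] 0 := fun x hx => by
    by_cases hxc : x ∈ closure s
    · filter_upwards [h0 x (hs.frontier_eq ▸ ⟨hxc, hx⟩)] with y hy
      by_cases hys : y ∈ s <;> simp [hys, hy]
    · filter_upwards [isClosed_closure.isOpen_compl.mem_nhds hxc] with y hy
      rw [indicator_of_notMem fun h => hy (subset_closure h)]
      rfl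
  have hG : ContDiff ℝ ∞ (s.indicator g) := contDiff_iff_contDiffAt.2 fun x => by
    by_cases hx : x ∈ s
    · exact hg.contDiffAt.congr_of_eventuallyEq (hin x hx)
    · exact contDiffAt_const.congr_of_eventuallyEq (hout x hx)
  have hc : HasCompactSupport (s.indicator g) :=
    HasCompactSupport.intro hb.isCompact_closure fun x hx =>
      indicator_of_notMem (fun h => hx (subset_closure h)) _
  rw [← integral_fderiv_eq_zero_of_hasCompactSupport (μ := μ) hG hc e,
    ← setIntegral_eq_integral_of_forall_compl_eq_zero (s := s)
      (f := fun x => fderiv ℝ (s.indicator g) x e)]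
  · refine setIntegral_congr_fun hs.measurableSet fun x hx => ?_
    rw [(hin x hx).fderiv_eq (𝕜 := ℝ)]
  · intro x hx
    rw [(hout x hx).fderiv_eq (𝕜 := ℝ)]
    simp

lemma fderiv_ex_eq (hψ : ContDiff ℝ ∞ ψ) (i : Fin d) (x : EuclideanSpace ℝ (Fin d)) (t : ℝ) :
    fderiv ℝ ψ (x, t) (ex i) = fderiv ℝ (fun y => ψ (y, t)) x (EuclideanSpace.single i 1) := by
  have h := (hψ.differentiable (by simp) (x, t)).hasFDerivAt.comp x
    (hasFDerivAt_prodMk_left (𝕜 := ℝ) x t)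
  have h2 : fderiv ℝ (fun y => ψ (y, t)) x = _ := h.fderiv
  rw [h2]
  rfl

lemma hasDerivAt_time (hψ : ContDiff ℝ ∞ ψ) (x : EuclideanSpace ℝ (Fin d)) (t : ℝ) :
    HasDerivAt (fun s => ψ (x, s)) (fderiv ℝ ψ (x, t) et) t := by
  have h := ((hψ.differentiable (by simp) (x, t)).hasFDerivAt.comp t
    (hasFDerivAt_prodMk_right (𝕜 := ℝ) x t)).hasDerivAt
  exact h

lemma integrableOn_of_continuous {U : Set (SpaceTime d)} (hU : Bornology.IsBounded U)
    (hφ : Continuous φ) : IntegrableOn φ U :=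
  (hφ.continuousOn.integrableOn_compact hU.isCompact_closure).mono_set subset_closure

lemma IsSmoothE.integral_fderiv_ex (hΩo : IsOpen Ωs) (hΩb : Bornology.IsBounded Ωs)
    (hψ : IsSmoothE Ωs T ψ) (i : Fin d) : ∫ p in cyl Ωs T, fderiv ℝ ψ p (ex i) = 0 := by
  have hint : IntegrableOn (fun p => fderiv ℝ ψ p (ex i)) (cyl Ωs T) :=
    integrableOn_of_continuous (isBounded_cyl hΩb T) (contDiff_dirDeriv hψ.1 _).continuous
  -- Fubini with space innermost: each time slice vanishes near the frontier of `Ωs`.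
  rw [cyl, Measure.volume_eq_prod, ← setIntegral_prod_swap, setIntegral_prod]
  · refine integral_eq_zero_of_ae ?_
    rw [Filter.EventuallyEq, ae_restrict_iff' measurableSet_Ioo]
    refine Eventually.of_forall fun t ht => ?_
    simp only [Prod.swap_prod_mk, fderiv_ex_eq hψ.1]
    refine setIntegral_fderiv_eq_zero hΩo hΩb (hψ.1.comp (by fun_prop)) (fun x hx => ?_) _
    exact (Continuous.tendsto' (by fun_prop : Continuous fun y : EuclideanSpace ℝ (Fin d) => (y, t))
      x (x, t) rfl).eventually (hψ.2 (x, t) (Or.inl ⟨hx, Ioo_subset_Icc_self ht⟩))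
  · have := hint
    rw [cyl, Measure.volume_eq_prod, IntegrableOn, ← Measure.prod_restrict] at this
    rw [IntegrableOn, ← Measure.prod_restrict]
    exact this.swap

lemma IsSmoothE.integral_fderiv_et (hΩo : IsOpen Ωs) (hΩb : Bornology.IsBounded Ωs) (hT : 0 < T)
    (hψ : IsSmoothE Ωs T ψ) :
    ∫ p in cyl Ωs T, fderiv ℝ ψ p et = ∫ x in Ωs, ψ (x, T) := by
  have hcont := (contDiff_dirDeriv hψ.1 et).continuous
  have hint : IntegrableOn (fun p => fderiv ℝ ψ p et) (cyl Ωs T) :=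
    integrableOn_of_continuous (isBounded_cyl hΩb T) hcont
  rw [cyl, Measure.volume_eq_prod] at hint ⊢
  rw [setIntegral_prod _ hint]
  refine setIntegral_congr_fun hΩo.measurableSet fun x hx => ?_
  have h0 : ψ (x, 0) = 0 := (hψ.2 (x, 0) (Or.inr ⟨subset_closure hx, rfl⟩)).self_of_nhds
  rw [← integral_Ioc_eq_integral_Ioo, ← intervalIntegral.integral_of_le hT.le,
    intervalIntegral.integral_eq_sub_of_hasDerivAt (fun t _ => hasDerivAt_time hψ.1 x t), h0,
    sub_zero]
  exact (hcont.comp (by fun_prop : Continuous fun t : ℝ => (x, t))).intervalIntegrable _ _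

lemma fderiv_mul_self (hφ : ContDiff ℝ ∞ φ) (p e : SpaceTime d) :
    fderiv ℝ (fun p => φ p * φ p) p e = 2 * (fderiv ℝ φ p e * φ p) := by
  have h := hφ.differentiable (by simp) p
  rw [fderiv_fun_mul h h]
  simp
  ring

lemma IsSmoothE.integral_ex_mul_self (hΩo : IsOpen Ωs) (hΩb : Bornology.IsBounded Ωs)
    (hφ : IsSmoothE Ωs T φ) (i : Fin d) : ∫ p in cyl Ωs T, fderiv ℝ φ p (ex i) * φ p = 0 := by
  have := hφ.mul_self.integral_fderiv_ex hΩo hΩb i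
  simp only [fderiv_mul_self hφ.1, integral_const_mul] at this
  linarith

lemma IsSmoothE.two_mul_integral_et_mul_self (hΩo : IsOpen Ωs) (hΩb : Bornology.IsBounded Ωs)
    (hT : 0 < T) (hφ : IsSmoothE Ωs T φ) :
    2 * ∫ p in cyl Ωs T, fderiv ℝ φ p et * φ p = ∫ x in Ωs, φ (x, T) * φ (x, T) := by
  have ht := hφ.mul_self.integral_fderiv_et hΩo hΩb hT
  simpa only [fderiv_mul_self hφ.1, integral_const_mul] using ht

end StreamlineDiffusion
namespace StreamlineDiffusion

/-! ### Final-time traces -/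

section L2

variable {X : Type*} [MeasurableSpace X] {μ : Measure X}

lemma inner_toLp {f g : X → ℝ} (hf : MemLp f 2 μ) (hg : MemLp g 2 μ) :
    inner ℝ (hf.toLp f) (hg.toLp g) = ∫ x, f x * g x ∂μ := by
  rw [L2.inner_def]
  refine integral_congr_ae ?_
  filter_upwards [hf.coeFn_toLp, hg.coeFn_toLp] with x h1 h2
  rw [h1, h2]
  simp [mul_comm]

lemma norm_toLp_sq {f : X → ℝ} (hf : MemLp f 2 μ) : ‖hf.toLp f‖ ^ 2 = ∫ x, f x * f x ∂μ := by
  rw [← real_inner_self_eq_norm_sq, inner_toLp]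

lemma tendsto_toLp {a : ℕ → X → ℝ} {f : X → ℝ} (ha : ∀ n, MemLp (a n) 2 μ) (hf : MemLp f 2 μ)
    (h : Tendsto (fun n => eLpNorm (fun x => a n x - f x) 2 μ) atTop (𝓝 0)) :
    Tendsto (fun n => (ha n).toLp (a n)) atTop (𝓝 (hf.toLp f)) :=
  (Lp.tendsto_Lp_iff_tendsto_eLpNorm'' a ha f hf).2 h

lemma tendsto_integral_mul {a b : ℕ → X → ℝ} {f g : X → ℝ} (ha : ∀ n, MemLp (a n) 2 μ)
    (hb : ∀ n, MemLp (b n) 2 μ) (hf : MemLp f 2 μ) (hg : MemLp g 2 μ)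
    (h1 : Tendsto (fun n => eLpNorm (fun x => a n x - f x) 2 μ) atTop (𝓝 0))
    (h2 : Tendsto (fun n => eLpNorm (fun x => b n x - g x) 2 μ) atTop (𝓝 0)) :
    Tendsto (fun n => ∫ x, a n x * b n x ∂μ) atTop (𝓝 (∫ x, f x * g x ∂μ)) := by
  have := (tendsto_toLp ha hf h1).inner (𝕜 := ℝ) (tendsto_toLp hb hg h2)
  simpa only [inner_toLp] using this

end L2

variable {d : ℕ} {Ωs : Set (EuclideanSpace ℝ (Fin d))} {T : ℝ} {w v φ ψ : SpaceTime d → ℝ}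

lemma memLp_slice (hΩb : Bornology.IsBounded Ωs) (hφ : Continuous φ) (t : ℝ) :
    MemLp (fun x => φ (x, t)) 2 (volume.restrict Ωs) := by
  have hc : IsCompact (closure Ωs) := hΩb.isCompact_closure
  have : IsFiniteMeasure (volume.restrict (closure Ωs) : Measure (EuclideanSpace ℝ (Fin d))) :=
    ⟨by simpa using hc.measure_lt_top⟩
  have hφ' : Continuous fun x => φ (x, t) := by fun_prop
  obtain ⟨C, hC⟩ := hc.exists_bound_of_continuousOn hφ'.continuousOn
  exact (MemLp.of_bound hφ'.aestronglyMeasurable C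
    ((ae_restrict_iff' isClosed_closure.measurableSet).2 (Eventually.of_forall hC))).mono_measure
    (Measure.restrict_mono subset_closure le_rfl)

/-- The trace inequality ‖z(T)‖² = 2∫ z_t z ≤ 2‖z_t‖‖z‖ for z = φ − ψ. It makes the final values of
an H¹-convergent sequence Cauchy. -/
lemma IsSmoothE.norm_slice_sub_sq_le (hΩo : IsOpen Ωs) (hΩb : Bornology.IsBounded Ωs) (hT : 0 < T)
    (hφ : IsSmoothE Ωs T φ) (hψ : IsSmoothE Ωs T ψ) :
    let U := isBounded_cyl hΩb T
    ‖(memLp_slice hΩb hφ.1.continuous T).toLp _ - (memLp_slice hΩb hψ.1.continuous T).toLp _‖ ^ 2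
      ≤ 2 * (‖(memLp_of_continuous U (contDiff_dirDeriv hφ.1 et).continuous).toLp _
          - (memLp_of_continuous U (contDiff_dirDeriv hψ.1 et).continuous).toLp _‖
        * ‖(memLp_of_continuous U hφ.1.continuous).toLp _
          - (memLp_of_continuous U hψ.1.continuous).toLp _‖) := by
  intro U
  have h := (hφ.sub hψ).two_mul_integral_et_mul_self hΩo hΩb hT
  have hfd : ∀ p, fderiv ℝ (fun p => φ p - ψ p) p et = fderiv ℝ φ p et - fderiv ℝ ψ p et :=
    fun p => by
      rw [fderiv_fun_sub (hφ.1.differentiable (by simp) p) (hψ.1.differentiable (by simp) p)]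
      rfl
  simp only [hfd] at h
  rw [← MemLp.toLp_sub, ← MemLp.toLp_sub, ← MemLp.toLp_sub, norm_toLp_sq]
  refine h.symm.le.trans ?_
  rw [mul_le_mul_iff_right₀ two_pos]
  refine le_trans (le_of_eq ?_) (real_inner_le_norm _ _)
  rw [inner_toLp]
  rfl

lemma MemH1E.exists_isFinalTrace (hΩo : IsOpen Ωs) (hΩb : Bornology.IsBounded Ωs) (hT : 0 < T)
    (hw : MemH1E Ωs T w) : ∃ g, IsFinalTrace Ωs T w g := by
  obtain ⟨hw1, φ, hφ, hconv⟩ := hw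
  have U := isBounded_cyl hΩb T
  have h1 := (tendsto_toLp (fun n => memLp_of_continuous U (hφ n).1.continuous) hw1.1
    hconv.1).cauchySeq
  have h2 := (tendsto_toLp (fun n => memLp_of_continuous U
    (contDiff_dirDeriv (hφ n).1 et).continuous) hw1.hasWeakDeriv_et.1 hconv.2.2).cauchySeq
  have h3 : CauchySeq fun n => (memLp_slice hΩb (hφ n).1.continuous T).toLp _ := by
    rw [Metric.cauchySeq_iff] at h1 h2 ⊢
    intro ε hε
    obtain ⟨N1, hN1⟩ := h1 (ε / 2) (by positivity)
    obtain ⟨N2, hN2⟩ := h2 (ε / 2) (by positivity)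
    refine ⟨max N1 N2, fun m hm n hn => ?_⟩
    have e1 := hN1 m (le_trans (le_max_left _ _) hm) n (le_trans (le_max_left _ _) hn)
    have e2 := hN2 m (le_trans (le_max_right _ _) hm) n (le_trans (le_max_right _ _) hn)
    have e3 := (hφ m).norm_slice_sub_sq_le hΩo hΩb hT (hφ n)
    simp only [dist_eq_norm] at e1 e2 ⊢
    refine lt_of_pow_lt_pow_left₀ 2 hε.le (e3.trans_lt ?_)
    have := mul_le_mul e2.le e1.le (norm_nonneg _) (by positivity)
    nlinarith
  obtain ⟨g, hg⟩ := cauchySeq_tendsto_of_complete h3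
  refine ⟨g, Lp.memLp g, φ, hφ, hconv, ?_⟩
  rw [← Lp.toLp_coeFn g (Lp.memLp g)] at hg
  exact (Lp.tendsto_Lp_iff_tendsto_eLpNorm'' _ _ _ _).1 hg

/-- Limit of the smooth identity along the sequence that defines the trace. It holds for any trace
`g`, so uniqueness of traces is never required. -/
lemma IsFinalTrace.two_mul_integral_et (hΩo : IsOpen Ωs) (hΩb : Bornology.IsBounded Ωs)
    (hT : 0 < T) (hw : MemH1 (cyl Ωs T) w) {g : EuclideanSpace ℝ (Fin d) → ℝ}
    (hg : IsFinalTrace Ωs T w g) :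
    2 * ∫ p in cyl Ωs T, weakDeriv (cyl Ωs T) et w p * w p = ∫ x in Ωs, g x * g x := by
  obtain ⟨hg2, φ, hφ, hconv, htr⟩ := hg
  have U := isBounded_cyl hΩb T
  have h1 := tendsto_integral_mul
    (fun n => memLp_of_continuous U (contDiff_dirDeriv (hφ n).1 et).continuous)
    (fun n => memLp_of_continuous U (hφ n).1.continuous) hw.hasWeakDeriv_et.1 hw.1
    hconv.2.2 hconv.1
  have h2 := tendsto_integral_mul (fun n => memLp_slice hΩb (hφ n).1.continuous T)
    (fun n => memLp_slice hΩb (hφ n).1.continuous T) hg2 hg2 htr htr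
  refine tendsto_nhds_unique (h1.const_mul 2) ?_
  simpa only [(hφ _).two_mul_integral_et_mul_self hΩo hΩb hT] using h2

lemma MemH1E.integral_ex_mul_self (hΩo : IsOpen Ωs) (hΩb : Bornology.IsBounded Ωs)
    (hw : MemH1E Ωs T w) (i : Fin d) :
    ∫ p in cyl Ωs T, weakDeriv (cyl Ωs T) (ex i) w p * w p = 0 := by
  obtain ⟨hw1, φ, hφ, hconv⟩ := hw
  have U := isBounded_cyl hΩb T
  have h1 := tendsto_integral_mul
    (fun n => memLp_of_continuous U (contDiff_dirDeriv (hφ n).1 (ex i)).continuous)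
    (fun n => memLp_of_continuous U (hφ n).1.continuous) (hw1.hasWeakDeriv_ex i).1 hw1.1
    (hconv.2.1 i) hconv.1
  simp only [(hφ _).integral_ex_mul_self hΩo hΩb i] at h1
  exact tendsto_nhds_unique h1 tendsto_const_nhds

lemma MemH1.memLp_streamDeriv (hw : MemH1 (cyl Ωs T) w) (β : EuclideanSpace ℝ (Fin d)) :
    MemLp (streamDeriv Ωs T β w) 2 (volume.restrict (cyl Ωs T)) :=
  hw.hasWeakDeriv_et.1.add (memLp_finsetSum _ fun i _ => (hw.hasWeakDeriv_ex i).1.const_mul (β i))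

lemma MemH1.streamDeriv_sub (hΩo : IsOpen Ωs) (hw : MemH1 (cyl Ωs T) w) (hv : MemH1 (cyl Ωs T) v)
    (β : EuclideanSpace ℝ (Fin d)) :
    streamDeriv Ωs T β (fun p => w p - v p) =ᵐ[volume.restrict (cyl Ωs T)]
      fun p => streamDeriv Ωs T β w p - streamDeriv Ωs T β v p := by
  have hU := isOpen_cyl hΩo T
  have h := ae_all_iff.2 fun i => hw.weakDeriv_ex_sub hU hv i
  filter_upwards [h, hw.weakDeriv_et_sub hU hv] with p h1 h2
  simp only [streamDeriv, h1, h2, mul_sub, Finset.sum_sub_distrib]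
  ring

/-- The convection field is skew symmetric up to the final time slice. -/
lemma MemH1E.integral_finalTrace_sq (hΩo : IsOpen Ωs) (hΩb : Bornology.IsBounded Ωs)
    (hT : 0 < T) (hw : MemH1E Ωs T w) (β : EuclideanSpace ℝ (Fin d)) :
    ∫ x in Ωs, finalTrace Ωs T w x ^ 2 = 2 * ∫ p in cyl Ωs T, streamDeriv Ωs T β w p * w p := by
  have h := hw.exists_isFinalTrace hΩo hΩb hT
  have hg : IsFinalTrace Ωs T w (finalTrace Ωs T w) := by
    rw [finalTrace, dif_pos h]
    exact h.choose_spec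
  simp only [pow_two]
  rw [← hg.two_mul_integral_et hΩo hΩb hT hw.1]
  simp only [streamDeriv, add_mul, Finset.sum_mul, mul_assoc]
  rw [integral_add (integrable_mul_of_memLp hw.1.hasWeakDeriv_et.1 hw.1.1)
      (integrable_finsetSum _ fun i _ =>
        (integrable_mul_of_memLp (hw.1.hasWeakDeriv_ex i).1 hw.1.1).const_mul _),
    integral_finsetSum _ fun i _ =>
        (integrable_mul_of_memLp (hw.1.hasWeakDeriv_ex i).1 hw.1.1).const_mul _]
  simp only [integral_const_mul, hw.integral_ex_mul_self hΩo hΩb, mul_zero, Finset.sum_const_zero,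
    add_zero]

end StreamlineDiffusion
namespace StreamlineDiffusion

variable {d : ℕ} {Ωs : Set (EuclideanSpace ℝ (Fin d))} {T σ h : ℝ}
  {𝒯 : Set (Set (SpaceTime d))} {K U : Set (SpaceTime d)} {w v l l' φ ψ : SpaceTime d → ℝ}

/-! ### Tessellations -/

namespace IsTessellation

lemma convex (h𝒯 : IsTessellation Ωs T σ h 𝒯) (hK : K ∈ 𝒯) : Convex ℝ K := by
  obtain ⟨s, rfl⟩ := h𝒯.polytope K hK
  exact convex_convexHull ℝ _

lemma isBounded (h𝒯 : IsTessellation Ωs T σ h 𝒯) (hK : K ∈ 𝒯) : Bornology.IsBounded K := by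
  obtain ⟨s, rfl⟩ := h𝒯.polytope K hK
  exact isBounded_convexHull.2 s.finite_toSet.isBounded

/-- A point of the cylinder outside all the interiors lies on the frontier of some element, and
frontiers of convex sets are null. -/
lemma cyl_ae_eq (h𝒯 : IsTessellation Ωs T σ h 𝒯) :
    (⋃ K ∈ h𝒯.finite.toFinset, interior K) =ᵐ[volume] cyl Ωs T := by
  have hsub : (⋃ K ∈ h𝒯.finite.toFinset, interior K) ⊆ cyl Ωs T :=
    iUnion₂_subset fun K hK => h𝒯.interior_subset K (by simpa using hK)
  refine hsub.eventuallyLE.antisymm ?_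
  rw [ae_le_set]
  refine measure_mono_null (t := ⋃ K ∈ h𝒯.finite.toFinset, frontier K) ?_ ?_
  · rintro p ⟨hp, hp'⟩
    have : p ∈ ⋃₀ 𝒯 := h𝒯.cover ▸ subset_closure hp
    obtain ⟨K, hK, hpK⟩ := this
    simp only [mem_iUnion, Finite.mem_toFinset, not_exists] at hp' ⊢
    exact ⟨K, hK, subset_closure hpK, hp' K hK⟩
  · refine (measure_biUnion_null_iff (Finset.countable_toSet _)).2 fun K hK => ?_
    exact (h𝒯.convex (by simpa using hK)).addHaar_frontier volume

lemma ae_restrict_cyl (h𝒯 : IsTessellation Ωs T σ h 𝒯) {P : SpaceTime d → Prop}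
    (hP : ∀ K ∈ 𝒯, ∀ᵐ p ∂(volume.restrict (interior K)), P p) :
    ∀ᵐ p ∂(volume.restrict (cyl Ωs T)), P p := by
  rw [← Measure.restrict_congr_set h𝒯.cyl_ae_eq]
  rw [ae_restrict_biUnion_finset_iff]
  intro K hK
  exact hP K (by simpa using hK)

lemma integral_cyl (h𝒯 : IsTessellation Ωs T σ h 𝒯) {F : SpaceTime d → ℝ}
    (hF : IntegrableOn F (cyl Ωs T)) :
    ∫ p in cyl Ωs T, F p = ∑ K ∈ h𝒯.finite.toFinset, ∫ p in interior K, F p := by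
  rw [← Measure.restrict_congr_set h𝒯.cyl_ae_eq, integral_biUnion_finset]
  · exact fun K _ => isOpen_interior.measurableSet
  · exact fun K hK K' hK' hne => h𝒯.disjoint K (by simpa using hK) K' (by simpa using hK') hne
  · exact fun K hK => hF.mono_set (h𝒯.interior_subset K (by simpa using hK))

/-- Some element exists and contains a ball of radius `h / σ`, whose interior must fit in the time
interval of length `T`. This bounds `h` by data independent of the mesh. -/
lemma size_lt (h𝒯 : IsTessellation Ωs T σ h 𝒯) (hΩn : Ωs.Nonempty) (hT : 0 < T) (hσ : 0 < σ)
    (hh : 0 < h) : h < σ * T := by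
  obtain ⟨x, hx⟩ := hΩn
  have hxc : ((x, T / 2) : SpaceTime d) ∈ ⋃₀ 𝒯 := h𝒯.cover ▸
    subset_closure ⟨hx, ⟨by simp [hT], by simp [hT]⟩⟩
  obtain ⟨K, hK, -⟩ := hxc
  obtain ⟨c, hc⟩ := h𝒯.shape K hK
  have hpos : 0 < h / σ := by positivity
  have hop : IsOpen {q : SpaceTime d | ‖q.1 - c.1‖ ^ 2 + (q.2 - c.2) ^ 2 < (h / σ) ^ 2} :=
    isOpen_lt (by fun_prop) continuous_const
  have hin := (interior_maximal hc hop).trans (h𝒯.interior_subset K hK)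
  -- Two points of the open ball whose times differ by exactly h/σ.
  have h1 : ((c.1, c.2 + h / σ / 2) : SpaceTime d) ∈ cyl Ωs T := hin (by simp; nlinarith)
  have h2 : ((c.1, c.2 - h / σ / 2) : SpaceTime d) ∈ cyl Ωs T := hin (by simp; nlinarith)
  have h3 := h1.2.2
  have h4 := h2.2.1
  simp only at h3 h4
  have : h / σ < T := by linarith
  rwa [div_lt_iff₀ hσ, mul_comm] at this

end IsTessellation

/-! ### The elementwise Laplacian -/

lemma contDiff_spatialLaplacian (hφ : ContDiff ℝ ∞ φ) : ContDiff ℝ ∞ (spatialLaplacian φ) :=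
  ContDiff.sum fun i _ => contDiff_dirDeriv (contDiff_dirDeriv hφ (ex i)) (ex i)

lemma IsTest.spatialLaplacian (hφ : IsTest U φ) : IsTest U (spatialLaplacian φ) := by
  have hs : Function.support (StreamlineDiffusion.spatialLaplacian φ) ⊆ tsupport φ := by
    intro p hp
    by_contra hpn
    exact hp (Finset.sum_eq_zero fun i _ => image_eq_zero_of_notMem_tsupport
      (f := fun p => fderiv ℝ (fun q => fderiv ℝ φ q (ex i)) p (ex i)) fun h =>
        hpn (tsupport_dirDeriv_subset φ (ex i) (tsupport_dirDeriv_subset _ (ex i) h)))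
  exact ⟨contDiff_spatialLaplacian hφ.1, hφ.2.1.mono' hs,
    (closure_minimal hs (isClosed_tsupport φ)).trans hφ.2.2⟩

lemma integral_mul_spatialLaplacian_test (hU : MemH1 U w) (hφ : IsTest U φ) :
    ∫ p in U, w p * spatialLaplacian φ p
      = -∫ p in U, ∑ i, weakDeriv U (ex i) w p * fderiv ℝ φ p (ex i) := by
  simp only [spatialLaplacian, Finset.mul_sum]
  rw [integral_finsetSum _ fun i _ => integrable_mul_of_memLp hU.1
      (((hφ.dirDeriv (ex i)).dirDeriv (ex i)).memLp _),
    integral_finsetSum _ fun i _ => integrable_mul_of_memLp (hU.hasWeakDeriv_ex i).1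
      ((hφ.dirDeriv (ex i)).memLp _), ← Finset.sum_neg_distrib]
  exact Finset.sum_congr rfl fun i _ => (hU.hasWeakDeriv_ex i).2 _ (hφ.dirDeriv (ex i))

lemma integral_contDiff_mul_spatialLaplacian_test (hψ : ContDiff ℝ ∞ ψ) (hφ : IsTest U φ)
    (hU : Bornology.IsBounded U) :
    ∫ p in U, ψ p * spatialLaplacian φ p = ∫ p in U, spatialLaplacian ψ p * φ p := by
  simp only [spatialLaplacian, Finset.mul_sum, Finset.sum_mul]
  rw [integral_finsetSum _ fun i _ => integrable_mul_of_memLp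
      (memLp_of_continuous hU hψ.continuous) (((hφ.dirDeriv (ex i)).dirDeriv (ex i)).memLp _),
    integral_finsetSum _ fun i _ => integrable_mul_of_memLp (memLp_of_continuous hU
      (contDiff_dirDeriv (contDiff_dirDeriv hψ (ex i)) (ex i)).continuous) (hφ.memLp _)]
  refine Finset.sum_congr rfl fun i _ => ?_
  rw [integral_mul_dirDeriv_test hψ (hφ.dirDeriv (ex i)),
    integral_mul_dirDeriv_test (contDiff_dirDeriv hψ (ex i)) hφ, neg_neg]

namespace IsBrokenLaplacian

/-- Localized uniqueness: inside one element the broken Laplacian can be identified with any L²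
candidate, in particular with a classical Laplacian. -/
lemma ae_eq_interior (h𝒯 : IsTessellation Ωs T σ h 𝒯) (hl : IsBrokenLaplacian Ωs T 𝒯 w l)
    (hK : K ∈ 𝒯) (hl' : MemLp l' 2 (volume.restrict (interior K)))
    (H : ∀ φ, IsTest (interior K) φ →
      ∫ p in interior K, w p * spatialLaplacian φ p = ∫ p in interior K, l' p * φ p) :
    l =ᵐ[volume.restrict (interior K)] l' := by
  refine ae_eq_of_forall_test isOpen_interior
    (hl.1.mono_measure (Measure.restrict_mono (h𝒯.interior_subset K hK) le_rfl)) hl' fun φ hφ => ?_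
  rw [← H φ hφ, ← hφ.setIntegral_mul_eq interior_subset,
    ← hφ.spatialLaplacian.setIntegral_mul_eq interior_subset, hl.2 K hK φ hφ]

lemma ae_eq (h𝒯 : IsTessellation Ωs T σ h 𝒯) (hl : IsBrokenLaplacian Ωs T 𝒯 w l)
    (hl' : IsBrokenLaplacian Ωs T 𝒯 w l') : l =ᵐ[volume.restrict (cyl Ωs T)] l' := by
  refine h𝒯.ae_restrict_cyl fun K hK => hl.ae_eq_interior h𝒯 hK
    (hl'.1.mono_measure (Measure.restrict_mono (h𝒯.interior_subset K hK) le_rfl)) fun φ hφ => ?_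
  rw [← hφ.setIntegral_mul_eq interior_subset,
    ← hφ.spatialLaplacian.setIntegral_mul_eq interior_subset, hl'.2 K hK φ hφ]

lemma spec (hl : IsBrokenLaplacian Ωs T 𝒯 w l) :
    IsBrokenLaplacian Ωs T 𝒯 w (brokenLaplacian Ωs T 𝒯 w) := by
  have h : ∃ l, IsBrokenLaplacian Ωs T 𝒯 w l := ⟨l, hl⟩
  rw [brokenLaplacian, dif_pos h]
  exact h.choose_spec

lemma sub (h𝒯 : IsTessellation Ωs T σ h 𝒯) (hw : MemLp w 2 (volume.restrict (cyl Ωs T)))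
    (hv : MemLp v 2 (volume.restrict (cyl Ωs T))) (hl : IsBrokenLaplacian Ωs T 𝒯 w l)
    (hl' : IsBrokenLaplacian Ωs T 𝒯 v l') :
    IsBrokenLaplacian Ωs T 𝒯 (fun p => w p - v p) (fun p => l p - l' p) := by
  refine ⟨hl.1.sub hl'.1, fun K hK φ hφ => ?_⟩
  have h1 := hl.2 K hK φ hφ
  have h2 := hl'.2 K hK φ hφ
  rw [hφ.setIntegral_mul_eq interior_subset,
    hφ.spatialLaplacian.setIntegral_mul_eq interior_subset] at h1 h2 ⊢
  have hm : ∀ {g : SpaceTime d → ℝ}, MemLp g 2 (volume.restrict (cyl Ωs T)) →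
      MemLp g 2 (volume.restrict (interior K)) := fun hg =>
    hg.mono_measure (Measure.restrict_mono (h𝒯.interior_subset K hK) le_rfl)
  simp only [sub_mul]
  rw [integral_sub (integrable_mul_of_memLp (hm hw) (hφ.spatialLaplacian.memLp _))
      (integrable_mul_of_memLp (hm hv) (hφ.spatialLaplacian.memLp _)),
    integral_sub (integrable_mul_of_memLp (hm hl.1) (hφ.memLp _))
      (integrable_mul_of_memLp (hm hl'.1) (hφ.memLp _)), h1, h2]

end IsBrokenLaplacian

/-- A weak solution satisfies the equation in `L²`, and its Laplacian is square integrable. -/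
lemma IsWeakSolution.isBrokenLaplacian (hΩo : IsOpen Ωs) (hΩb : Bornology.IsBounded Ωs)
    (h𝒯 : IsTessellation Ωs T σ h 𝒯) {α γ : ℝ} (hα : 0 < α) {β : EuclideanSpace ℝ (Fin d)}
    {f u : SpaceTime d → ℝ} (hf : MemLp f 2 (volume.restrict (cyl Ωs T)))
    (hu : IsWeakSolution Ωs T α β γ f u) :
    IsBrokenLaplacian Ωs T 𝒯 u (fun p => α⁻¹ * (streamDeriv Ωs T β u p + γ * u p - f p)) := by
  have hD := hu.1.1.memLp_streamDeriv β
  have hm := ((hD.add (hu.1.1.1.const_mul γ)).sub hf)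
  refine ⟨hm.const_mul α⁻¹, fun K hK φ hφK => ?_⟩
  -- A test function of one element is a test function of the cylinder, hence admissible in the weak
  -- formulation.
  have hφ : IsTest (cyl Ωs T) φ := hφK.mono (h𝒯.interior_subset K hK)
  have hL : ∀ g : SpaceTime d → ℝ, ∫ p in K, g p * φ p = ∫ p in cyl Ωs T, g p * φ p := fun g => by
    rw [hφK.setIntegral_mul_eq interior_subset,
      hφK.setIntegral_mul_eq (h𝒯.interior_subset K hK)]
  have hL' : ∫ p in K, u p * spatialLaplacian φ p
      = ∫ p in cyl Ωs T, u p * spatialLaplacian φ p := by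
    rw [hφK.spatialLaplacian.setIntegral_mul_eq interior_subset,
      hφK.spatialLaplacian.setIntegral_mul_eq (h𝒯.interior_subset K hK)]
  rw [hL, hL', integral_mul_spatialLaplacian_test hu.1.1 hφ]
  have hweak := hu.2 φ ((hφ.isSmoothE hΩo).memH1E hΩo hΩb)
  have hG : Integrable (fun p => ∑ i, weakDeriv (cyl Ωs T) (ex i) u p * fderiv ℝ φ p (ex i))
      (volume.restrict (cyl Ωs T)) := integrable_finsetSum _ fun i _ =>
    integrable_mul_of_memLp (hu.1.1.hasWeakDeriv_ex i).1 ((hφ.dirDeriv (ex i)).memLp _)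
  have hform : formB Ωs T α β γ u φ = ∫ p in cyl Ωs T, (streamDeriv Ωs T β u p * φ p
      + α * ∑ i, weakDeriv (cyl Ωs T) (ex i) u p * fderiv ℝ φ p (ex i) + γ * (u p * φ p)) := by
    refine integral_congr_ae ?_
    have := ae_all_iff.2 fun i => (hasWeakDeriv_of_contDiff (isBounded_cyl hΩb T) hφ.1
      (ex i)).weakDeriv_ae_eq (isOpen_cyl hΩo T)
    filter_upwards [this] with p hp
    simp only [hp]
  have i1 := integrable_mul_of_memLp hD (hφ.memLp (volume.restrict (cyl Ωs T)))
  have i2 := integrable_mul_of_memLp hu.1.1.1 (hφ.memLp (volume.restrict (cyl Ωs T)))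
  have i3 := integrable_mul_of_memLp hf (hφ.memLp (volume.restrict (cyl Ωs T)))
  have i4 : Integrable (fun p => streamDeriv Ωs T β u p * φ p
      + α * ∑ i, weakDeriv (cyl Ωs T) (ex i) u p * fderiv ℝ φ p (ex i))
      (volume.restrict (cyl Ωs T)) := i1.add (hG.const_mul α)
  have i5 : Integrable (fun p => streamDeriv Ωs T β u p * φ p + γ * (u p * φ p))
      (volume.restrict (cyl Ωs T)) := i1.add (i2.const_mul γ)
  rw [hform, integral_add i4 (i2.const_mul γ),
    integral_add i1 (hG.const_mul α), integral_const_mul, integral_const_mul] at hweak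
  have hrhs : ∫ p in cyl Ωs T, α⁻¹ * (streamDeriv Ωs T β u p + γ * u p - f p) * φ p
      = α⁻¹ * ((∫ p in cyl Ωs T, streamDeriv Ωs T β u p * φ p)
        + γ * (∫ p in cyl Ωs T, u p * φ p) - ∫ p in cyl Ωs T, f p * φ p) := by
    rw [← integral_const_mul, ← integral_add i1 (i2.const_mul γ),
      ← integral_sub i5 i3, ← integral_const_mul]
    refine integral_congr_ae (Eventually.of_forall fun p => ?_)
    simp only
    ring
  rw [hrhs, ← hweak]
  field_simp
  ring

end StreamlineDiffusion
namespace StreamlineDiffusion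

/-! ### Polynomials and the inverse estimate -/

section Polynomials

open MvPolynomial

variable {d : ℕ}

/-- Evaluation of a polynomial in `(x, t)`, as a function on space-time. -/
noncomputable def polyEval (d : ℕ) : MvPolynomial (Fin d ⊕ Unit) ℝ →ₗ[ℝ] (SpaceTime d → ℝ) where
  toFun P p := eval (Sum.elim (fun i => p.1 i) (fun _ => p.2)) P
  map_add' P Q := by ext p; simp
  map_smul' a P := by ext p; simp [smul_eval]

/-- The polynomial functions of degree at most `r` on space-time. -/
noncomputable def polyFun (d r : ℕ) : Submodule ℝ (SpaceTime d → ℝ) :=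
  (restrictTotalDegree (Fin d ⊕ Unit) ℝ r).map (polyEval d)

instance (d r : ℕ) : FiniteDimensional ℝ (polyFun d r) :=
  inferInstanceAs (Module.Finite ℝ ((restrictTotalDegree (Fin d ⊕ Unit) ℝ r).map (polyEval d)))

lemma analyticOnNhd_of_mem_polyFun {r : ℕ} {w : SpaceTime d → ℝ} (hw : w ∈ polyFun d r) :
    AnalyticOnNhd ℝ w univ := by
  obtain ⟨P, -, rfl⟩ := hw
  refine AnalyticOnNhd.aeval_mvPolynomial
    (f := fun p : SpaceTime d => Sum.elim (fun i => p.1 i) (fun _ => p.2)) ?_ P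
  rintro (i | i)
  · exact ((EuclideanSpace.proj i : EuclideanSpace ℝ (Fin d) →L[ℝ] ℝ).comp
      (ContinuousLinearMap.fst ℝ _ ℝ)).analyticOnNhd _
  · exact (ContinuousLinearMap.snd ℝ (EuclideanSpace ℝ (Fin d)) ℝ).analyticOnNhd _

lemma contDiff_of_mem_polyFun {r : ℕ} {w : SpaceTime d → ℝ} (hw : w ∈ polyFun d r) :
    ContDiff ℝ ∞ w :=
  contDiffOn_univ.1 ((analyticOnNhd_of_mem_polyFun hw).contDiffOn uniqueDiffOn_univ)

/-- Translations and dilations preserve the polynomial space, which is what the scaling argument for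
the inverse estimate needs. -/
lemma totalDegree_aeval_affine_le {ι : Type*} (P : MvPolynomial ι ℝ) (a : ι → ℝ) (b : ℝ) :
    (aeval (fun j => C (a j) + C b * X j) P : MvPolynomial ι ℝ).totalDegree ≤ P.totalDegree := by
  rw [aeval_def, eval₂_eq]
  refine totalDegree_finsetSum_le fun m hm => ?_
  have hlin : ∀ j, (C (a j) + C b * X j : MvPolynomial ι ℝ).totalDegree ≤ 1 := fun j => by
    refine (totalDegree_add _ _).trans (max_le (by simp) ((totalDegree_mul _ _).trans ?_))
    simp [totalDegree_X]
  refine (totalDegree_mul _ _).trans ?_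
  rw [algebraMap_eq, totalDegree_C, zero_add]
  refine (totalDegree_finsetProd _ _).trans (le_trans ?_ (le_totalDegree hm))
  exact Finset.sum_le_sum fun j _ => (totalDegree_pow _ _).trans
    (by simpa using Nat.mul_le_mul_left (m j) (hlin j))

lemma comp_affine_mem_polyFun {r : ℕ} {w : SpaceTime d → ℝ} (hw : w ∈ polyFun d r)
    (c : SpaceTime d) (h : ℝ) : (fun y => w (c + h • y)) ∈ polyFun d r := by
  obtain ⟨P, hP, rfl⟩ := hw
  refine ⟨aeval (fun j => C (Sum.elim (fun i => c.1 i) (fun _ => c.2) j) + C h * X j) P,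
    (mem_restrictTotalDegree _ _ _).2 ((totalDegree_aeval_affine_le P _ h).trans
      ((mem_restrictTotalDegree _ _ _).1 hP)), ?_⟩
  ext y
  simp only [polyEval, LinearMap.coe_mk, AddHom.coe_mk]
  rw [aeval_def, eval₂_comp_left]
  change _ = eval₂ (RingHom.id ℝ) _ P
  congr 1
  · ext a
    simp [algebraMap_eq]
  · ext j
    rcases j with j | j <;> simp

end Polynomials

/-! ### Bounding the Laplacian of a polynomial by its gradient -/

section InverseEstimate

variable {d r : ℕ} {w : SpaceTime d → ℝ}

/-- On a finite-dimensional space, a linear map is bounded by any linear map with smaller kernel. -/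
lemma exists_norm_le_of_ker_le {W X Y : Type*} [AddCommGroup W] [Module ℝ W]
    [FiniteDimensional ℝ W] [NormedAddCommGroup X] [NormedSpace ℝ X] [NormedAddCommGroup Y]
    [NormedSpace ℝ Y] (N : W →ₗ[ℝ] X) (A : W →ₗ[ℝ] Y)
    (hker : ∀ w, N w = 0 → A w = 0) : ∃ C : ℝ, 0 ≤ C ∧ ∀ w, ‖A w‖ ≤ C * ‖N w‖ := by
  -- With `S` a linear section of `N` over its range, `w - S (N w)` lies in the kernel of `N`, hence
  -- in that of `A`. So `A` factors through the finite-dimensional range, where `A ∘ₗ S` is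
  -- continuous.
  obtain ⟨S, hS⟩ := N.rangeRestrict.exists_rightInverse_of_surjective N.range_rangeRestrict
  refine ⟨‖(A ∘ₗ S).toContinuousLinearMap‖, ContinuousLinearMap.opNorm_nonneg _, fun w => ?_⟩
  have h1 : N (w - S (N.rangeRestrict w)) = 0 := by
    have : N (S (N.rangeRestrict w)) = N w :=
      congrArg Subtype.val (LinearMap.congr_fun hS (N.rangeRestrict w))
    rw [map_sub, this, sub_self]
  have h2 := hker _ h1
  rw [map_sub, sub_eq_zero] at h2
  rw [h2]
  exact (A ∘ₗ S).toContinuousLinearMap.le_opNorm (N.rangeRestrict w)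

/-- A linear map into square-integrable functions, as a map into `L²`. -/
noncomputable def toLpLinear {W X : Type*} [AddCommGroup W] [Module ℝ W] [MeasurableSpace X] {μ : Measure X}
    (A : W →ₗ[ℝ] (X → ℝ)) (hA : ∀ w, MemLp (A w) 2 μ) : W →ₗ[ℝ] Lp ℝ 2 μ where
  toFun w := (hA w).toLp _
  map_add' v w := by
    rw [← MemLp.toLp_add]
    exact MemLp.toLp_congr _ _ (by rw [map_add])
  map_smul' a w := by
    rw [RingHom.id_apply, ← MemLp.toLp_const_smul]
    exact MemLp.toLp_congr _ _ (by rw [map_smul])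

/-- Directional derivatives of polynomial functions. -/
noncomputable def polyDeriv (d r : ℕ) (e : SpaceTime d) : polyFun d r →ₗ[ℝ] (SpaceTime d → ℝ) where
  toFun w p := fderiv ℝ w.1 p e
  map_add' v w := by
    ext p
    have hv := (contDiff_of_mem_polyFun v.2).differentiable (by simp) p
    have hw := (contDiff_of_mem_polyFun w.2).differentiable (by simp) p
    simp [fderiv_add hv hw]
  map_smul' a w := by
    ext p
    have hw := (contDiff_of_mem_polyFun w.2).differentiable (by simp) p
    simp [fderiv_const_smul hw]

lemma spatialLaplacian_add {φ ψ : SpaceTime d → ℝ} (hφ : ContDiff ℝ ∞ φ) (hψ : ContDiff ℝ ∞ ψ) :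
    spatialLaplacian (φ + ψ) = spatialLaplacian φ + spatialLaplacian ψ := by
  ext p
  simp only [spatialLaplacian, Pi.add_apply, ← Finset.sum_add_distrib]
  refine Finset.sum_congr rfl fun i _ => ?_
  have h1 : (fun q => fderiv ℝ (φ + ψ) q (ex i))
      = fun q => fderiv ℝ φ q (ex i) + fderiv ℝ ψ q (ex i) := by
    ext q
    rw [fderiv_add (hφ.differentiable (by simp) q) (hψ.differentiable (by simp) q)]
    rfl
  rw [h1, fderiv_fun_add ((contDiff_dirDeriv hφ _).differentiable (by simp) p)
    ((contDiff_dirDeriv hψ _).differentiable (by simp) p)]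
  rfl

lemma spatialLaplacian_smul {φ : SpaceTime d → ℝ} (hφ : ContDiff ℝ ∞ φ) (a : ℝ) :
    spatialLaplacian (a • φ) = a • spatialLaplacian φ := by
  ext p
  simp only [spatialLaplacian, Pi.smul_apply, smul_eq_mul, Finset.mul_sum]
  refine Finset.sum_congr rfl fun i _ => ?_
  have h1 : (fun q => fderiv ℝ (a • φ) q (ex i)) = fun q => a * fderiv ℝ φ q (ex i) := by
    ext q
    rw [fderiv_const_smul (hφ.differentiable (by simp) q)]
    rfl
  rw [h1, fderiv_const_mul ((contDiff_dirDeriv hφ _).differentiable (by simp) p)]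
  rfl

/-- The spatial Laplacian of polynomial functions. -/
noncomputable def polyLaplacian (d r : ℕ) : polyFun d r →ₗ[ℝ] (SpaceTime d → ℝ) where
  toFun w := spatialLaplacian w.1
  map_add' v w := spatialLaplacian_add (contDiff_of_mem_polyFun v.2) (contDiff_of_mem_polyFun w.2)
  map_smul' a w := spatialLaplacian_smul (contDiff_of_mem_polyFun w.2) a

/-- The open Euclidean ball in space-time. -/
def eball (c : SpaceTime d) (R : ℝ) : Set (SpaceTime d) :=
  {q | ‖q.1 - c.1‖ ^ 2 + (q.2 - c.2) ^ 2 < R ^ 2}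

/-- The closed Euclidean ball in space-time. -/
def eclosedBall (c : SpaceTime d) (R : ℝ) : Set (SpaceTime d) :=
  {q | ‖q.1 - c.1‖ ^ 2 + (q.2 - c.2) ^ 2 ≤ R ^ 2}

lemma isOpen_eball (c : SpaceTime d) (R : ℝ) : IsOpen (eball c R) :=
  isOpen_lt (by fun_prop) continuous_const

lemma isClosed_eclosedBall (c : SpaceTime d) (R : ℝ) : IsClosed (eclosedBall c R) :=
  isClosed_le (by fun_prop) continuous_const

lemma isBounded_eclosedBall (c : SpaceTime d) (R : ℝ) :
    Bornology.IsBounded (eclosedBall c R) := by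
  refine Metric.isBounded_closedBall (x := c) (r := |R|) |>.subset fun q hq => ?_
  have hq' : ‖q.1 - c.1‖ ^ 2 + (q.2 - c.2) ^ 2 ≤ R ^ 2 := hq
  rw [Metric.mem_closedBall, dist_eq_norm, Prod.norm_def, max_le_iff]
  constructor
  · rw [← abs_norm, Prod.fst_sub]
    exact sq_le_sq.1 (by nlinarith [sq_nonneg (q.2 - c.2)])
  · exact sq_le_sq.1 (by simp only [Prod.snd_sub]; nlinarith [sq_nonneg ‖q.1 - c.1‖])

lemma eball_subset_eclosedBall (c : SpaceTime d) (R : ℝ) : eball c R ⊆ eclosedBall c R :=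
  fun _ hq => le_of_lt (mem_ofPred.1 hq)

/-- Almost everywhere equality of continuous functions on an open set is equality there, and the
identity theorem for analytic functions extends it to the whole space. -/
lemma polyFun_dirDeriv_eq_zero (hw : w ∈ polyFun d r) {R : ℝ} (hR : 0 < R) (e : SpaceTime d)
    (h : (fun p => fderiv ℝ w p e) =ᵐ[volume.restrict (eball 0 R)] 0) :
    (fun p => fderiv ℝ w p e) = 0 := by
  have h1 : EqOn (fun p => fderiv ℝ w p e) 0 (eball 0 R) :=
    Measure.eqOn_open_of_ae_eq h (isOpen_eball 0 R)
      (contDiff_dirDeriv (contDiff_of_mem_polyFun hw) e).continuous.continuousOn continuousOn_const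
  have ha : AnalyticOnNhd ℝ (fun p => fderiv ℝ w p e) univ := fun p _ =>
    ((ContinuousLinearMap.apply ℝ ℝ e).analyticAt _).comp
      ((analyticOnNhd_of_mem_polyFun hw).fderiv p (mem_univ p))
  exact ha.eq_of_eventuallyEq (g := 0) (fun _ _ => analyticAt_const) (z₀ := 0)
    (h1.eventuallyEq_of_mem ((isOpen_eball 0 R).mem_nhds (by simp [eball, hR])))

/-- Finite dimensionality: if the spatial gradient vanishes on the small ball it vanishes
everywhere, hence so does the Laplacian on the large ball. -/
lemma exists_inverse_estimate_reference (d r : ℕ) {ρ : ℝ} (hρ : 0 < ρ) :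
    ∃ C : ℝ, 0 ≤ C ∧ ∀ w ∈ polyFun d r, ∫ p in eclosedBall 0 1, spatialLaplacian w p ^ 2
      ≤ C * ∑ i, ∫ p in eball 0 ρ, fderiv ℝ w p (ex i) ^ 2 := by
  have hb : Bornology.IsBounded (eball (0 : SpaceTime d) ρ) :=
    (isBounded_eclosedBall 0 ρ).subset (eball_subset_eclosedBall 0 ρ)
  have hN : ∀ i, ∀ w : polyFun d r, MemLp (polyDeriv d r (ex i) w) 2
      (volume.restrict (eball 0 ρ)) := fun i w => memLp_of_continuous hb
    (contDiff_dirDeriv (contDiff_of_mem_polyFun w.2) (ex i)).continuous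
  have hA : ∀ w : polyFun d r, MemLp (polyLaplacian d r w) 2
      (volume.restrict (eclosedBall 0 1)) := fun w =>
    memLp_of_continuous (isBounded_eclosedBall 0 1)
      (contDiff_spatialLaplacian (contDiff_of_mem_polyFun w.2)).continuous
  obtain ⟨C, hC0, hC⟩ := exists_norm_le_of_ker_le
    (LinearMap.pi fun i => toLpLinear (polyDeriv d r (ex i)) (hN i))
    (toLpLinear (polyLaplacian d r) hA) (fun w hw => by
      have hz : ∀ i, (fun p => fderiv ℝ w.1 p (ex i)) = 0 := fun i => by
        have h1 : (hN i w).toLp _ = 0 := congrFun hw i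
        exact polyFun_dirDeriv_eq_zero w.2 hρ (ex i)
          ((hN i w).coeFn_toLp.symm.trans (Lp.eq_zero_iff_ae_eq_zero.1 h1))
      refine Lp.eq_zero_iff_ae_eq_zero.2
        ((hA w).coeFn_toLp.trans (Eventually.of_forall fun p => ?_))
      change ∑ i, fderiv ℝ (fun q => fderiv ℝ w.1 q (ex i)) p (ex i) = 0
      refine Finset.sum_eq_zero fun i _ => ?_
      rw [hz i]
      simp)
  refine ⟨C ^ 2, by positivity, fun w hw => ?_⟩
  have h1 := hC ⟨w, hw⟩
  have h2 : ‖(hA ⟨w, hw⟩).toLp _‖ ^ 2 ≤ (C * ‖(LinearMap.pi fun i =>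
      toLpLinear (polyDeriv d r (ex i)) (hN i)) (⟨w, hw⟩ : polyFun d r)‖) ^ 2 :=
    pow_le_pow_left₀ (norm_nonneg _) h1 2
  rw [norm_toLp_sq, mul_pow] at h2
  simp only [pow_two (spatialLaplacian w _)]
  refine h2.trans (mul_le_mul_of_nonneg_left ?_ (by positivity))
  have h3 : ∀ i, ‖(hN i ⟨w, hw⟩).toLp _‖ ^ 2
      = ∫ p in eball 0 ρ, fderiv ℝ w p (ex i) ^ 2 := fun i => by
    rw [norm_toLp_sq]
    simp only [pow_two]
    rfl
  -- The product of the L² spaces carries the sup norm, so it suffices to bound each component by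
  -- the full sum.
  rw [← Real.le_sqrt (norm_nonneg _) (Finset.sum_nonneg fun i _ => integral_nonneg
    fun p => sq_nonneg _), pi_norm_le_iff_of_nonneg (Real.sqrt_nonneg _)]
  intro i
  refine Real.le_sqrt_of_sq_le ?_
  refine (h3 i).le.trans (Finset.single_le_sum
    (f := fun i => ∫ p in eball 0 ρ, fderiv ℝ w p (ex i) ^ 2)
    (fun i _ => integral_nonneg fun p => sq_nonneg _) (Finset.mem_univ i))

lemma fderiv_comp_affine {φ : SpaceTime d → ℝ} (hφ : ContDiff ℝ ∞ φ) (c : SpaceTime d) (h : ℝ)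
    (y e : SpaceTime d) :
    fderiv ℝ (fun y => φ (c + h • y)) y e = h * fderiv ℝ φ (c + h • y) e := by
  have h1 : HasFDerivAt (fun y : SpaceTime d => c + h • y)
      (h • ContinuousLinearMap.id ℝ (SpaceTime d)) y :=
    ((hasFDerivAt_id y).const_smul h).const_add c
  have h2 : fderiv ℝ (fun y => φ (c + h • y)) y = _ :=
    ((hφ.differentiable (by simp) (c + h • y)).hasFDerivAt.comp y h1).fderiv
  rw [h2]
  simp

lemma spatialLaplacian_comp_affine {φ : SpaceTime d → ℝ} (hφ : ContDiff ℝ ∞ φ) (c : SpaceTime d)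
    (h : ℝ) (y : SpaceTime d) :
    spatialLaplacian (fun y => φ (c + h • y)) y = h ^ 2 * spatialLaplacian φ (c + h • y) := by
  simp only [spatialLaplacian, Finset.mul_sum]
  refine Finset.sum_congr rfl fun i _ => ?_
  simp only [fderiv_comp_affine hφ]
  have h1 : ContDiff ℝ ∞ fun q => fderiv ℝ φ (c + h • q) (ex i) :=
    (contDiff_dirDeriv hφ (ex i)).comp (by fun_prop)
  rw [fderiv_const_mul (h1.differentiable (by simp) y), smul_apply, fderiv_comp_affine (contDiff_dirDeriv hφ (ex i)), smul_eq_mul]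
  ring

lemma setIntegral_comp_affine {S S' : Set (SpaceTime d)} (hS : MeasurableSet S)
    (hS' : MeasurableSet S') (c : SpaceTime d) {h : ℝ} (hh : 0 < h)
    (hSS' : ∀ y, c + h • y ∈ S' ↔ y ∈ S) (f : SpaceTime d → ℝ) :
    ∫ p in S', f p = h ^ Module.finrank ℝ (SpaceTime d) * ∫ y in S, f (c + h • y) := by
  have h1 : S.indicator (fun y => f (c + h • y)) = fun y => S'.indicator f (c + h • y) := by
    ext y
    by_cases hy : y ∈ S
    · rw [indicator_of_mem hy, indicator_of_mem ((hSS' y).2 hy)]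
    · rw [indicator_of_notMem hy, indicator_of_notMem fun hc => hy ((hSS' y).1 hc)]
  rw [← integral_indicator hS, ← integral_indicator hS', h1,
    Measure.integral_comp_smul volume (fun y => S'.indicator f (c + y)) h,
    integral_add_left_eq_self, abs_of_nonneg (by positivity), smul_eq_mul,
    mul_inv_cancel_left₀ (by positivity)]

/-- Rescaling by y ↦ c + h y turns the two balls enclosing `S` into the fixed balls of radii 1/σ and
1. Sandwiching `S` between balls makes the constant independent of its shape. -/
lemma exists_inverse_estimate (d r : ℕ) {σ : ℝ} (hσ : 0 < σ) :
    ∃ C : ℝ, 0 ≤ C ∧ ∀ (h : ℝ) (c : SpaceTime d) (S : Set (SpaceTime d)), 0 < h →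
      eball c (h / σ) ⊆ S → S ⊆ eclosedBall c h → ∀ w ∈ polyFun d r,
      h ^ 2 * ∫ p in S, spatialLaplacian w p ^ 2
        ≤ C * ∑ i, ∫ p in S, fderiv ℝ w p (ex i) ^ 2 := by
  obtain ⟨C, hC0, hC⟩ := exists_inverse_estimate_reference d r (ρ := 1 / σ) (by positivity)
  refine ⟨C, hC0, fun h c S hh hin hout w hw => ?_⟩
  have hsm := contDiff_of_mem_polyFun hw
  have hscale : ∀ y : SpaceTime d, ‖(c + h • y).1 - c.1‖ ^ 2 + ((c + h • y).2 - c.2) ^ 2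
      = h ^ 2 * (‖y.1‖ ^ 2 + y.2 ^ 2) := fun y => by
    simp only [Prod.fst_add, Prod.snd_add, Prod.smul_fst, Prod.smul_snd, add_sub_cancel_left,
      norm_smul, smul_eq_mul, mul_pow, Real.norm_eq_abs, sq_abs]
    ring
  have hout' : ∀ y, c + h • y ∈ eclosedBall c h ↔ y ∈ eclosedBall 0 1 := fun y => by
    simp only [eclosedBall, mem_ofPred, hscale, Prod.fst_zero, Prod.snd_zero, sub_zero, one_pow]
    exact ⟨fun H => le_of_mul_le_mul_left (by simpa using H) (by positivity : 0 < h ^ 2),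
      fun H => by simpa using mul_le_mul_of_nonneg_left H (by positivity : 0 ≤ h ^ 2)⟩
  have hin' : ∀ y, c + h • y ∈ eball c (h / σ) ↔ y ∈ eball 0 (1 / σ) := fun y => by
    have e : (h / σ) ^ 2 = h ^ 2 * (1 / σ) ^ 2 := by ring
    simp only [eball, mem_ofPred, hscale, Prod.fst_zero, Prod.snd_zero, sub_zero, e]
    exact mul_lt_mul_iff_right₀ (by positivity)
  have h1 : ∫ p in S, spatialLaplacian w p ^ 2 ≤ ∫ p in eclosedBall c h, spatialLaplacian w p ^ 2 :=
    setIntegral_mono_set (integrableOn_of_continuous (isBounded_eclosedBall c h)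
      ((contDiff_spatialLaplacian hsm).continuous.pow 2))
      (Eventually.of_forall fun p => sq_nonneg _) hout.eventuallyLE
  have h2 : ∀ i, ∫ p in eball c (h / σ), fderiv ℝ w p (ex i) ^ 2
      ≤ ∫ p in S, fderiv ℝ w p (ex i) ^ 2 := fun i =>
    setIntegral_mono_set (integrableOn_of_continuous ((isBounded_eclosedBall c h).subset hout)
      ((contDiff_dirDeriv hsm (ex i)).continuous.pow 2))
      (Eventually.of_forall fun p => sq_nonneg _) hin.eventuallyLE
  have h3 := hC _ (comp_affine_mem_polyFun hw c h)
  simp only [spatialLaplacian_comp_affine hsm, fderiv_comp_affine hsm, mul_pow,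
    integral_const_mul] at h3
  rw [setIntegral_comp_affine (isClosed_eclosedBall 0 1).measurableSet
    (isClosed_eclosedBall c h).measurableSet c hh hout'] at h1
  simp only [setIntegral_comp_affine (isOpen_eball 0 (1 / σ)).measurableSet
    (isOpen_eball c (h / σ)).measurableSet c hh hin'] at h2
  have h4 := Finset.sum_le_sum fun i (_ : i ∈ Finset.univ) => h2 i
  refine le_trans ?_ (mul_le_mul_of_nonneg_left h4 hC0)
  rw [← Finset.mul_sum] at h3 ⊢
  set n := Module.finrank ℝ (SpaceTime d)
  have h5 := mul_le_mul_of_nonneg_left h1 (by positivity : 0 ≤ h ^ 2)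
  have h6 : h ^ 2 * (∫ y in eclosedBall 0 1, spatialLaplacian w (c + h • y) ^ 2)
      ≤ C * ∑ i, ∫ y in eball 0 (1 / σ), fderiv ℝ w (c + h • y) (ex i) ^ 2 := by
    -- The squared Laplacian scales with h⁴ and the squared gradient with h². One factor h² cancels
    -- and the other remains in the estimate.
    refine le_of_mul_le_mul_left ?_ (by positivity : 0 < h ^ 2)
    linarith
  have h7 := mul_le_mul_of_nonneg_left h6 (by positivity : 0 ≤ h ^ n)
  linarith

end InverseEstimate

end StreamlineDiffusion
namespace StreamlineDiffusion

variable {d r : ℕ} {Ωs : Set (EuclideanSpace ℝ (Fin d))} {T σ h : ℝ}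
  {𝒯 : Set (Set (SpaceTime d))} {K : Set (SpaceTime d)} {w v q : SpaceTime d → ℝ}

/-! ### The finite element space -/

lemma exists_polyFun_of_mem_FESpace (hv : v ∈ FESpace Ωs T 𝒯 r) (hK : K ∈ 𝒯) :
    ∃ q ∈ polyFun d r, EqOn v q K := by
  obtain ⟨P, hP, hvP⟩ := hv.2.2 K hK
  exact ⟨polyEval d P, ⟨P, (MvPolynomial.mem_restrictTotalDegree _ _ _).2 hP, rfl⟩, hvP⟩

lemma sub_mem_FESpace (hΩo : IsOpen Ωs) (hw : w ∈ FESpace Ωs T 𝒯 r) (hv : v ∈ FESpace Ωs T 𝒯 r) :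
    (fun p => w p - v p) ∈ FESpace Ωs T 𝒯 r := by
  refine ⟨hw.1.sub hv.1, hw.2.1.sub hΩo hv.2.1, fun K hK => ?_⟩
  obtain ⟨P, hP, hwP⟩ := hw.2.2 K hK
  obtain ⟨Q, hQ, hvQ⟩ := hv.2.2 K hK
  refine ⟨P - Q, (MvPolynomial.totalDegree_sub P Q).trans (max_le hP hQ), fun p hp => ?_⟩
  rw [map_sub, ← hwP p hp, ← hvQ p hp]

lemma integral_interior_mul_spatialLaplacian (h𝒯 : IsTessellation Ωs T σ h 𝒯) (hK : K ∈ 𝒯)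
    (hq : ContDiff ℝ ∞ q) (hvq : EqOn v q K) {φ : SpaceTime d → ℝ} (hφ : IsTest (interior K) φ) :
    ∫ p in interior K, v p * spatialLaplacian φ p
      = ∫ p in interior K, spatialLaplacian q p * φ p := by
  rw [← integral_contDiff_mul_spatialLaplacian_test hq hφ
    ((h𝒯.isBounded hK).subset interior_subset)]
  refine setIntegral_congr_fun isOpen_interior.measurableSet fun p hp => ?_
  simp only [hvq (interior_subset hp)]

lemma exists_isBrokenLaplacian_of_mem_FESpace (h𝒯 : IsTessellation Ωs T σ h 𝒯)
    (hv : v ∈ FESpace Ωs T 𝒯 r) : ∃ l, IsBrokenLaplacian Ωs T 𝒯 v l := by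
  have H : ∀ K ∈ 𝒯, ∃ q, q ∈ polyFun d r ∧ EqOn v q K := fun K hK =>
    exists_polyFun_of_mem_FESpace hv hK
  choose! q hq hvq using H
  -- The classical Laplacians of the polynomial pieces, glued together. The interiors are disjoint,
  -- so at most one summand is nonzero at any point.
  refine ⟨fun p => ∑ K ∈ h𝒯.finite.toFinset, (interior K).indicator (spatialLaplacian (q K)) p,
    memLp_finsetSum _ fun K hK => ?_, fun K hK φ hφ => ?_⟩
  · have hK' : K ∈ 𝒯 := by simpa using hK
    exact (memLp_indicator_iff_restrict isOpen_interior.measurableSet).2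
      ((memLp_of_continuous ((h𝒯.isBounded hK').subset interior_subset)
        (contDiff_spatialLaplacian (contDiff_of_mem_polyFun (hq K hK'))).continuous).mono_measure
          (Measure.restrict_mono le_rfl Measure.restrict_le_self))
  · rw [hφ.setIntegral_mul_eq interior_subset,
      hφ.spatialLaplacian.setIntegral_mul_eq interior_subset,
      integral_interior_mul_spatialLaplacian h𝒯 hK (contDiff_of_mem_polyFun (hq K hK))
        (hvq K hK) hφ]
    refine setIntegral_congr_fun isOpen_interior.measurableSet fun p hp => ?_
    rw [Finset.sum_eq_single K, indicator_of_mem hp]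
    · intro K' hK' hne
      exact indicator_of_notMem (fun h' => disjoint_left.1
        (h𝒯.disjoint K' (by simpa using hK') K hK hne) h' hp) _
    · intro hn
      exact absurd (by simpa using hK) hn

/-- Inside each element the weak gradient and the broken Laplacian coincide almost everywhere with
the classical ones of the polynomial piece. The polynomial estimate is applied there and summed over
elements. -/
lemma exists_inverse_estimate_FESpace (d r : ℕ) {σ : ℝ} (hσ : 0 < σ) :
    ∃ C : ℝ, 0 ≤ C ∧ ∀ (Ωs : Set (EuclideanSpace ℝ (Fin d))) (T h : ℝ)
      (𝒯 : Set (Set (SpaceTime d))), 0 < h → IsTessellation Ωs T σ h 𝒯 →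
      ∀ v ∈ FESpace Ωs T 𝒯 r, h ^ 2 * ∫ p in cyl Ωs T, brokenLaplacian Ωs T 𝒯 v p ^ 2
        ≤ C * ∑ i, ∫ p in cyl Ωs T, weakDeriv (cyl Ωs T) (ex i) v p ^ 2 := by
  obtain ⟨C, hC0, hC⟩ := exists_inverse_estimate d r hσ
  refine ⟨C, hC0, fun Ωs T h 𝒯 hh h𝒯 v hv => ?_⟩
  obtain ⟨l, hl⟩ := exists_isBrokenLaplacian_of_mem_FESpace h𝒯 hv
  have hl := hl.spec
  have hG := fun i => (hv.2.1.1.hasWeakDeriv_ex i)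
  rw [h𝒯.integral_cyl hl.1.integrable_sq]
  simp only [h𝒯.integral_cyl (hG _).1.integrable_sq]
  rw [Finset.sum_comm, Finset.mul_sum, Finset.mul_sum]
  refine Finset.sum_le_sum fun K hK => ?_
  have hK : K ∈ 𝒯 := by simpa using hK
  obtain ⟨q, hq, hvq⟩ := exists_polyFun_of_mem_FESpace hv hK
  have hqs := contDiff_of_mem_polyFun hq
  have hb : Bornology.IsBounded (interior K) := (h𝒯.isBounded hK).subset interior_subset
  have h1 := hl.ae_eq_interior h𝒯 hK
    (memLp_of_continuous hb (contDiff_spatialLaplacian hqs).continuous)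
    fun φ hφ => integral_interior_mul_spatialLaplacian h𝒯 hK hqs hvq hφ
  have h2 : ∀ i, weakDeriv (cyl Ωs T) (ex i) v =ᵐ[volume.restrict (interior K)]
      fun p => fderiv ℝ q p (ex i) := fun i =>
    ((hG i).mono (h𝒯.interior_subset K hK)).ae_eq isOpen_interior
      ((hasWeakDeriv_of_contDiff hb hqs (ex i)).congr
        ((ae_restrict_iff' isOpen_interior.measurableSet).2
          (Eventually.of_forall fun p hp => (hvq (interior_subset hp)).symm)))
  have h3 : ∫ p in interior K, brokenLaplacian Ωs T 𝒯 v p ^ 2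
      = ∫ p in interior K, spatialLaplacian q p ^ 2 :=
    integral_congr_ae (h1.mono fun p hp => by simp only [hp])
  have h4 : ∀ i, ∫ p in interior K, weakDeriv (cyl Ωs T) (ex i) v p ^ 2
      = ∫ p in interior K, fderiv ℝ q p (ex i) ^ 2 := fun i =>
    integral_congr_ae ((h2 i).mono fun p hp => by simp only [hp])
  simp only [h3, h4]
  obtain ⟨c, hc⟩ := h𝒯.shape K hK
  have hcK : c ∈ K := hc (by simpa using by positivity)
  exact hC h c (interior K) hh (interior_maximal hc (isOpen_eball c _))
    (interior_subset.trans fun p hp => h𝒯.size K hK p hp c hcK) q hq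

/-! ### The energy estimate in an inner product space -/

section Abstract

variable {H E : Type*} [NormedAddCommGroup H] [InnerProductSpace ℝ H] [NormedAddCommGroup E]
  [InnerProductSpace ℝ E]

open RealInnerProductSpace

lemma abs_inner_le_young (x y : H) {c : ℝ} (hc : 0 < c) :
    |⟪x, y⟫| ≤ c * ‖y‖ ^ 2 + (4 * c)⁻¹ * ‖x‖ ^ 2 := by
  refine (abs_real_inner_le_norm x y).trans ?_
  have h : 0 ≤ c * (‖y‖ - (2 * c)⁻¹ * ‖x‖) ^ 2 := by positivity
  have e : c * (‖y‖ - (2 * c)⁻¹ * ‖x‖) ^ 2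
      = c * ‖y‖ ^ 2 + (4 * c)⁻¹ * ‖x‖ ^ 2 - ‖x‖ * ‖y‖ := by field_simp; ring
  linarith

lemma norm_add_sq_le (x y : H) : ‖x + y‖ ^ 2 ≤ 2 * (‖x‖ ^ 2 + ‖y‖ ^ 2) := by
  have h := abs_inner_le_young x y (c := 1 / 2) (by norm_num)
  have h' := le_of_abs_le h
  rw [norm_add_sq_real]
  norm_num at h'
  linarith

/-- Stability of the streamline-diffusion form with respect to a discrete component `(y, b, k, m)`
and an approximation error `(x, a, g, l)`: values, streamline derivatives, gradients and
elementwise Laplacians. -/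
lemma stream_stability {x y a b l m : H} {g k : E} {α γ δ θ h R M CI : ℝ} (hα : 0 < α)
    (hαM : α ≤ M) (hγ : 0 ≤ γ) (hγM : γ ≤ M) (hδ : 0 < δ) (hδh : δ ≤ h ^ 2) (hδR : δ ≤ R)
    (hθ : 0 < θ) (hθM : 8 * θ * M * CI ≤ 1)
    (orth : ⟪a + b, y⟫ + α * ⟪g + k, k⟫ + γ * ⟪x + y, y⟫
      + θ * δ * ⟪a + b - α • (l + m) + γ • (x + y), b⟫ = 0)
    (hby : 0 ≤ ⟪b, y⟫) (hax : 0 ≤ ⟪a, x⟫) (hpos : 0 ≤ ⟪a + a + b, x + x + y⟫)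
    (hneg : 0 ≤ ⟪a - b, x - y⟫) (hinv : h ^ 2 * ‖m‖ ^ 2 ≤ CI * ‖k‖ ^ 2) :
    2 * ⟪a + b, x + y⟫ + α * ‖g + k‖ ^ 2 + δ * ‖a + b‖ ^ 2 + γ * ‖x + y‖ ^ 2
      ≤ (2 + (8 + 6 / θ) * (2 + 2 / θ + 2 * θ + 2 * θ * M + 2 * θ * R * M))
        * (2 * ⟪a, x⟫ + α * ‖g‖ ^ 2 + δ * ‖a‖ ^ 2 + γ * ‖x‖ ^ 2
          + (δ⁻¹ * ‖x‖ ^ 2 + α * h ^ 2 * ‖l‖ ^ 2)) := by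
  have hM : 0 < M := hα.trans_le hαM
  have hR : 0 < R := hδ.trans_le hδR
  simp only [inner_add_left, inner_add_right, inner_sub_left, inner_sub_right,
    real_inner_smul_left, real_inner_self_eq_norm_sq] at orth hpos hneg ⊢
  -- The weight θδ/8 is one of five equal shares of θδ‖b‖² spent by Young's inequality (`b1`,
  -- `b4`–`b7`). Hence 3/8 of that term survives in `core`.
  have b1 : ⟪b, x⟫ ≤ θ * δ / 8 * ‖b‖ ^ 2 + 2 / θ * (δ⁻¹ * ‖x‖ ^ 2) := by
    have h1 := le_of_abs_le (abs_inner_le_young x b (c := θ * δ / 8) (by positivity))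
    rw [real_inner_comm] at h1
    refine h1.trans (le_of_eq ?_)
    field_simp
    ring
  have b2 : -(α * ⟪g, k⟫) ≤ α * (1 / 4 * ‖k‖ ^ 2 + ‖g‖ ^ 2) := by
    have h1 := neg_le_of_abs_le (abs_inner_le_young g k (c := 1 / 4) (by norm_num))
    norm_num at h1
    nlinarith
  have b3 : -(γ * ⟪x, y⟫) ≤ γ * (1 / 2 * ‖y‖ ^ 2 + 1 / 2 * ‖x‖ ^ 2) := by
    have h1 := neg_le_of_abs_le (abs_inner_le_young x y (c := 1 / 2) (by norm_num))
    norm_num at h1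
    nlinarith
  have young : ∀ u : H, |⟪u, b⟫| ≤ 1 / 8 * ‖b‖ ^ 2 + 2 * ‖u‖ ^ 2 := fun u => by
    have h1 := abs_inner_le_young u b (c := 1 / 8) (by norm_num)
    norm_num at h1 ⊢
    exact h1
  have hθδ : 0 < θ * δ := mul_pos hθ hδ
  have scaled : ∀ (u : H) (c : ℝ),
      θ * δ * (c * ⟪u, b⟫) ≤ θ * δ * (1 / 8 * ‖b‖ ^ 2) + 2 * θ * (δ * (c ^ 2 * ‖u‖ ^ 2)) :=
    fun u c => by
      have h1 := le_of_abs_le (young (c • u))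
      rw [real_inner_smul_left, norm_smul, mul_pow, Real.norm_eq_abs, sq_abs] at h1
      have := mul_le_mul_of_nonneg_left h1 hθδ.le
      linarith
  -- One factor of the squared coefficient is traded for `M`, so that the bound stays linear in α or
  -- γ as in the energy. `S` is h² for the Laplacian terms and `R` for the zero-order term.
  have weight : ∀ {c : ℝ} (u : H), 0 ≤ c → c ≤ M → ∀ {S : ℝ}, δ ≤ S →
      δ * (c ^ 2 * ‖u‖ ^ 2) ≤ M * (c * (S * ‖u‖ ^ 2)) := fun {c} u hc hcM {S} hS => by
    have h1 : δ * (c * c) ≤ S * (M * c) :=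
      mul_le_mul hS (mul_le_mul_of_nonneg_right hcM hc) (by positivity) (hδ.le.trans hS)
    have := mul_le_mul_of_nonneg_right h1 (sq_nonneg ‖u‖)
    linarith
  have b4 := scaled a (-1)
  have b5 := scaled l α
  have b6 := scaled m α
  have b7 := scaled x (-γ)
  have w5 := mul_le_mul_of_nonneg_left (weight l hα.le hαM hδh) (by positivity : 0 ≤ 2 * θ)
  have w6 := mul_le_mul_of_nonneg_left (weight m hα.le hαM hδh) (by positivity : 0 ≤ 2 * θ)
  have w7 := mul_le_mul_of_nonneg_left (weight x hγ hγM hδR) (by positivity : 0 ≤ 2 * θ)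
  -- The inverse estimate and the smallness of θ are used only here, to absorb the discrete
  -- Laplacian into a quarter of the diffusion term.
  have w6' : 2 * θ * (M * (α * (h ^ 2 * ‖m‖ ^ 2))) ≤ 1 / 4 * (α * ‖k‖ ^ 2) := by
    have h1 := mul_le_mul_of_nonneg_left hinv (by positivity : 0 ≤ 2 * θ * (M * α))
    have h2 := mul_le_mul_of_nonneg_right hθM (by positivity : 0 ≤ 1 / 4 * (α * ‖k‖ ^ 2))
    linarith
  have hpγ : 0 ≤ θ * δ * (γ * ⟪b, y⟫) := by positivity
  rw [neg_sq] at b7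
  -- `orth` leaves −⟪a, y⟫, which `hpos` bounds by ⟪b, x⟫ + 2⟪a, x⟫ + ½⟪b, y⟫. This replaces
  -- integration by parts and costs half of ⟪b, y⟫.
  have core : 1 / 2 * ⟪b, y⟫ + 1 / 2 * (α * ‖k‖ ^ 2) + 1 / 2 * (γ * ‖y‖ ^ 2)
      + 3 / 8 * (θ * (δ * ‖b‖ ^ 2)) ≤ 2 * ⟪a, x⟫ + 2 / θ * (δ⁻¹ * ‖x‖ ^ 2) + α * ‖g‖ ^ 2
        + 1 / 2 * (γ * ‖x‖ ^ 2) + 2 * θ * (δ * ‖a‖ ^ 2) + 2 * θ * M * (α * h ^ 2 * ‖l‖ ^ 2)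
        + 2 * θ * R * M * (γ * ‖x‖ ^ 2) := by
    have hxb := real_inner_comm x b
    rw [real_inner_comm b y] at orth
    linarith
  set N := 2 * ⟪a, x⟫ + α * ‖g‖ ^ 2 + δ * ‖a‖ ^ 2 + γ * ‖x‖ ^ 2
          + (δ⁻¹ * ‖x‖ ^ 2 + α * h ^ 2 * ‖l‖ ^ 2) with hN
  have n1 : 0 ≤ α * ‖g‖ ^ 2 := by positivity
  have n2 : 0 ≤ δ * ‖a‖ ^ 2 := by positivity
  have n3 : 0 ≤ γ * ‖x‖ ^ 2 := by positivity
  have n4 : 0 ≤ δ⁻¹ * ‖x‖ ^ 2 := by positivity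
  have n5 : 0 ≤ α * h ^ 2 * ‖l‖ ^ 2 := by positivity
  have core2 : 2 * ⟪a, x⟫ + 2 / θ * (δ⁻¹ * ‖x‖ ^ 2) + α * ‖g‖ ^ 2
        + 1 / 2 * (γ * ‖x‖ ^ 2) + 2 * θ * (δ * ‖a‖ ^ 2) + 2 * θ * M * (α * h ^ 2 * ‖l‖ ^ 2)
        + 2 * θ * R * M * (γ * ‖x‖ ^ 2)
      ≤ (2 + 2 / θ + 2 * θ + 2 * θ * M + 2 * θ * R * M) * N := by
    have c1 := mul_le_mul_of_nonneg_left (show δ⁻¹ * ‖x‖ ^ 2 ≤ N by linarith)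
      (by positivity : 0 ≤ 2 / θ)
    have c2 := mul_le_mul_of_nonneg_left (show δ * ‖a‖ ^ 2 ≤ N by linarith)
      (by positivity : 0 ≤ 2 * θ)
    have c3 := mul_le_mul_of_nonneg_left (show α * h ^ 2 * ‖l‖ ^ 2 ≤ N by linarith)
      (by positivity : 0 ≤ 2 * θ * M)
    have c4 := mul_le_mul_of_nonneg_left (show γ * ‖x‖ ^ 2 ≤ N by linarith)
      (by positivity : 0 ≤ 2 * θ * R * M)
    linarith
  have m1 : 0 ≤ α * ‖k‖ ^ 2 := by positivity
  have m2 : 0 ≤ γ * ‖y‖ ^ 2 := by positivity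
  have m3 : 0 ≤ δ * ‖b‖ ^ 2 := by positivity
  have final := mul_le_mul_of_nonneg_left (core.trans core2) (by positivity : 0 ≤ 8 + 6 / θ)
  -- In the factor, 8 turns ½⟪b, y⟫ into 4⟪b, y⟫, and 6/θ turns (3/8)θδ‖b‖² into at least 2δ‖b‖².
  have expand : 4 * ⟪b, y⟫ + 2 * (α * ‖k‖ ^ 2) + 2 * (γ * ‖y‖ ^ 2) + 2 * (δ * ‖b‖ ^ 2)
      ≤ (8 + 6 / θ) * (1 / 2 * ⟪b, y⟫ + 1 / 2 * (α * ‖k‖ ^ 2) + 1 / 2 * (γ * ‖y‖ ^ 2)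
        + 3 / 8 * (θ * (δ * ‖b‖ ^ 2))) := by
    have e : (8 + 6 / θ) * (1 / 2 * ⟪b, y⟫ + 1 / 2 * (α * ‖k‖ ^ 2) + 1 / 2 * (γ * ‖y‖ ^ 2)
        + 3 / 8 * (θ * (δ * ‖b‖ ^ 2))) = 4 * ⟪b, y⟫ + 4 * (α * ‖k‖ ^ 2) + 4 * (γ * ‖y‖ ^ 2)
        + 6 / θ * (1 / 2 * ⟪b, y⟫ + 1 / 2 * (α * ‖k‖ ^ 2) + 1 / 2 * (γ * ‖y‖ ^ 2))
        + 3 * (θ * (δ * ‖b‖ ^ 2)) + 9 / 4 * (δ * ‖b‖ ^ 2) := by field_simp; ring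
    have : 0 ≤ 6 / θ * (1 / 2 * ⟪b, y⟫ + 1 / 2 * (α * ‖k‖ ^ 2) + 1 / 2 * (γ * ‖y‖ ^ 2)) := by
      positivity
    have : 0 ≤ θ * (δ * ‖b‖ ^ 2) := by positivity
    linarith
  have s1 := mul_le_mul_of_nonneg_left (norm_add_sq_le g k) hα.le
  have s2 := mul_le_mul_of_nonneg_left (norm_add_sq_le a b) hδ.le
  have s3 := mul_le_mul_of_nonneg_left (norm_add_sq_le x y) hγ
  -- `hneg` gives the remaining bound 2⟪a + b, x + y⟫ ≤ 4⟪a, x⟫ + 4⟪b, y⟫. The contributions of x, a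
  -- and g cost twice the right-hand energy, whence the leading 2 in the constant.
  linarith

end Abstract

end StreamlineDiffusion
namespace StreamlineDiffusion

open RealInnerProductSpace

variable {d r : ℕ} {Ωs : Set (EuclideanSpace ℝ (Fin d))} {T σ h : ℝ}
  {𝒯 : Set (Set (SpaceTime d))} {w v : SpaceTime d → ℝ}

/-! ### The variational problem in `L²` -/

lemma toLp_eq_sub {X : Type*} [MeasurableSpace X] {μ : Measure X} {f g k : X → ℝ}
    (hf : MemLp f 2 μ) (hg : MemLp g 2 μ) (hk : MemLp k 2 μ) (h : k =ᵐ[μ] fun x => f x - g x) :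
    hk.toLp k = hf.toLp f - hg.toLp g := by
  rw [← MemLp.toLp_sub]
  exact MemLp.toLp_congr _ _ h

/-- The class of `w ∈ H¹(Ω)` in `L²(Ω)`. -/
noncomputable def MemH1.val (hw : MemH1 (cyl Ωs T) w) : Lp ℝ 2 (volume.restrict (cyl Ωs T)) := hw.1.toLp w

/-- The streamline derivative in `L²(Ω)`. -/
noncomputable def MemH1.stream (hw : MemH1 (cyl Ωs T) w) (β : EuclideanSpace ℝ (Fin d)) :
    Lp ℝ 2 (volume.restrict (cyl Ωs T)) := (hw.memLp_streamDeriv β).toLp _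

/-- The spatial gradient in `L²(Ω)^d`. -/
noncomputable def MemH1.grad (hw : MemH1 (cyl Ωs T) w) :
    PiLp 2 (fun _ : Fin d => Lp ℝ 2 (volume.restrict (cyl Ωs T))) :=
  WithLp.toLp 2 fun i => (hw.hasWeakDeriv_ex i).1.toLp _

/-- The elementwise Laplacian in `L²(Ω)`. -/
noncomputable def IsBrokenLaplacian.lap (hl : IsBrokenLaplacian Ωs T 𝒯 w (brokenLaplacian Ωs T 𝒯 w)) :
    Lp ℝ 2 (volume.restrict (cyl Ωs T)) := hl.1.toLp _

lemma MemH1.val_sub (hw : MemH1 (cyl Ωs T) w) (hv : MemH1 (cyl Ωs T) v) :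
    (hw.sub hv).val = hw.val - hv.val :=
  toLp_eq_sub _ _ _ (by rfl)

lemma MemH1.stream_sub (hΩo : IsOpen Ωs) (hw : MemH1 (cyl Ωs T) w) (hv : MemH1 (cyl Ωs T) v)
    (β : EuclideanSpace ℝ (Fin d)) : (hw.sub hv).stream β = hw.stream β - hv.stream β :=
  toLp_eq_sub _ _ _ (hw.streamDeriv_sub hΩo hv β)

lemma MemH1.grad_sub (hΩo : IsOpen Ωs) (hw : MemH1 (cyl Ωs T) w) (hv : MemH1 (cyl Ωs T) v) :
    (hw.sub hv).grad = hw.grad - hv.grad := by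
  ext1 i
  exact toLp_eq_sub (hw.hasWeakDeriv_ex i).1 (hv.hasWeakDeriv_ex i).1
    ((hw.sub hv).hasWeakDeriv_ex i).1 (hw.weakDeriv_ex_sub (isOpen_cyl hΩo T) hv i)

lemma IsBrokenLaplacian.lap_sub (h𝒯 : IsTessellation Ωs T σ h 𝒯) (hw : MemH1 (cyl Ωs T) w)
    (hv : MemH1 (cyl Ωs T) v) (hl : IsBrokenLaplacian Ωs T 𝒯 w (brokenLaplacian Ωs T 𝒯 w))
    (hl' : IsBrokenLaplacian Ωs T 𝒯 v (brokenLaplacian Ωs T 𝒯 v)) :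
    (hl.sub h𝒯 hw.1 hv.1 hl').spec.lap = hl.lap - hl'.lap :=
  toLp_eq_sub _ _ _ ((hl.sub h𝒯 hw.1 hv.1 hl').spec.ae_eq h𝒯
    (hl.sub h𝒯 hw.1 hv.1 hl'))

lemma MemH1.inner_grad (hw : MemH1 (cyl Ωs T) w) (hv : MemH1 (cyl Ωs T) v) :
    ⟪hw.grad, hv.grad⟫
      = ∫ p in cyl Ωs T, ∑ i, weakDeriv (cyl Ωs T) (ex i) w p * weakDeriv (cyl Ωs T) (ex i) v p := by
  rw [integral_finsetSum _ fun i _ => integrable_mul_of_memLp (hw.hasWeakDeriv_ex i).1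
    (hv.hasWeakDeriv_ex i).1, PiLp.inner_apply]
  exact Finset.sum_congr rfl fun i _ => inner_toLp (hw.hasWeakDeriv_ex i).1
    (hv.hasWeakDeriv_ex i).1

lemma formB_eq (hw : MemH1 (cyl Ωs T) w) (hv : MemH1 (cyl Ωs T) v) (α γ : ℝ)
    (β : EuclideanSpace ℝ (Fin d)) :
    formB Ωs T α β γ w v
      = ⟪hw.stream β, hv.val⟫ + α * ⟪hw.grad, hv.grad⟫ + γ * ⟪hw.val, hv.val⟫ := by
  have i1 := integrable_mul_of_memLp (hw.memLp_streamDeriv β) hv.1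
  have i2 : Integrable (fun p => ∑ i, weakDeriv (cyl Ωs T) (ex i) w p
      * weakDeriv (cyl Ωs T) (ex i) v p) (volume.restrict (cyl Ωs T)) :=
    integrable_finsetSum _ fun i _ => integrable_mul_of_memLp (hw.hasWeakDeriv_ex i).1
      (hv.hasWeakDeriv_ex i).1
  have i3 := integrable_mul_of_memLp hw.1 hv.1
  have i4 : Integrable (fun p => streamDeriv Ωs T β w p * v p
    + α * ∑ i, weakDeriv (cyl Ωs T) (ex i) w p * weakDeriv (cyl Ωs T) (ex i) v p)
    (volume.restrict (cyl Ωs T)) := i1.add (i2.const_mul α)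
  rw [formB, integral_add i4 (i3.const_mul γ), integral_add i1 (i2.const_mul α),
    integral_const_mul, integral_const_mul, hw.inner_grad hv, MemH1.stream, MemH1.val, MemH1.val,
    inner_toLp, inner_toLp]

lemma MemH1E.two_mul_inner_stream (hΩo : IsOpen Ωs) (hΩb : Bornology.IsBounded Ωs) (hT : 0 < T)
    (hw : MemH1E Ωs T w) (β : EuclideanSpace ℝ (Fin d)) :
    2 * ⟪hw.1.stream β, hw.1.val⟫ = ∫ x in Ωs, finalTrace Ωs T w x ^ 2 := by
  rw [hw.integral_finalTrace_sq hΩo hΩb hT β, MemH1.stream, MemH1.val, inner_toLp]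

lemma MemH1E.inner_stream_nonneg (hΩo : IsOpen Ωs) (hΩb : Bornology.IsBounded Ωs) (hT : 0 < T)
    (hw : MemH1E Ωs T w) (β : EuclideanSpace ℝ (Fin d)) :
    0 ≤ ⟪hw.1.stream β, hw.1.val⟫ := by
  have h : 0 ≤ ∫ x in Ωs, finalTrace Ωs T w x ^ 2 := integral_nonneg fun x => sq_nonneg _
  rw [← hw.two_mul_inner_stream hΩo hΩb hT β] at h
  linarith

/-- With the trace term rewritten by the energy identity, the energy consists only of L² inner
products and fits the abstract estimate. -/
lemma energySq_eq (hΩo : IsOpen Ωs) (hΩb : Bornology.IsBounded Ωs) (hT : 0 < T)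
    (hw : MemH1E Ωs T w) (h α γ : ℝ) (β : EuclideanSpace ℝ (Fin d)) :
    energySq Ωs T h α β γ w = 2 * ⟪hw.1.stream β, hw.1.val⟫ + α * ‖hw.1.grad‖ ^ 2
      + h ^ 2 * nu β * ‖hw.1.stream β‖ ^ 2 + γ * ‖hw.1.val‖ ^ 2 := by
  have i1 : Integrable (fun p => ∑ i, weakDeriv (cyl Ωs T) (ex i) w p
      * weakDeriv (cyl Ωs T) (ex i) w p) (volume.restrict (cyl Ωs T)) :=
    integrable_finsetSum _ fun i _ => integrable_mul_of_memLp (hw.1.hasWeakDeriv_ex i).1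
      (hw.1.hasWeakDeriv_ex i).1
  have i2 := integrable_mul_of_memLp (hw.1.memLp_streamDeriv β) (hw.1.memLp_streamDeriv β)
  have i3 := integrable_mul_of_memLp hw.1.1 hw.1.1
  have i4 : Integrable (fun p => α * ∑ i, weakDeriv (cyl Ωs T) (ex i) w p
      * weakDeriv (cyl Ωs T) (ex i) w p + h ^ 2 * nu β
        * (streamDeriv Ωs T β w p * streamDeriv Ωs T β w p)) (volume.restrict (cyl Ωs T)) :=
    (i1.const_mul α).add (i2.const_mul (h ^ 2 * nu β))
  rw [energySq, hw.two_mul_inner_stream hΩo hΩb hT β]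
  simp only [pow_two (weakDeriv _ _ _ _), pow_two (streamDeriv _ _ _ _ _), pow_two (w _)]
  rw [integral_add i4 (i3.const_mul γ), integral_add (i1.const_mul α) (i2.const_mul _),
    integral_const_mul, integral_const_mul, integral_const_mul, ← hw.1.inner_grad hw.1,
    real_inner_self_eq_norm_sq, MemH1.stream, MemH1.val, norm_toLp_sq, norm_toLp_sq]
  ring

lemma integral_weighted_sq_eq (hw : MemH1 (cyl Ωs T) w)
    (hl : IsBrokenLaplacian Ωs T 𝒯 w (brokenLaplacian Ωs T 𝒯 w)) (a b : ℝ) :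
    ∫ p in cyl Ωs T, (a * w p ^ 2 + b * brokenLaplacian Ωs T 𝒯 w p ^ 2)
      = a * ‖hw.val‖ ^ 2 + b * ‖hl.lap‖ ^ 2 := by
  rw [integral_add (hw.1.integrable_sq.const_mul a) (hl.1.integrable_sq.const_mul b),
    integral_const_mul, integral_const_mul, MemH1.val, IsBrokenLaplacian.lap, norm_toLp_sq,
    norm_toLp_sq]
  simp only [pow_two]

lemma integral_opL_eq (hw : MemH1 (cyl Ωs T) w) (hv : MemH1 (cyl Ωs T) v)
    (hl : IsBrokenLaplacian Ωs T 𝒯 w (brokenLaplacian Ωs T 𝒯 w)) (α γ c : ℝ)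
    (β : EuclideanSpace ℝ (Fin d)) :
    ∫ p in cyl Ωs T, opL Ωs T 𝒯 α β γ w p * (c * streamDeriv Ωs T β v p)
      = c * ⟪hw.stream β - α • hl.lap + γ • hw.val, hv.stream β⟫ := by
  have hm : MemLp (opL Ωs T 𝒯 α β γ w) 2 (volume.restrict (cyl Ωs T)) :=
    ((hw.memLp_streamDeriv β).sub (hl.1.const_mul α)).add (hw.1.const_mul γ)
  have e : hw.stream β - α • hl.lap + γ • hw.val = hm.toLp _ := by
    rw [MemH1.stream, IsBrokenLaplacian.lap, MemH1.val, ← MemLp.toLp_const_smul,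
      ← MemLp.toLp_const_smul, ← MemLp.toLp_sub, ← MemLp.toLp_add]
    rfl
  rw [e, MemH1.stream, inner_toLp, ← integral_const_mul]
  exact integral_congr_ae (Eventually.of_forall fun p => by ring)

lemma integral_load_eq (hv : MemH1 (cyl Ωs T) v) {f : SpaceTime d → ℝ}
    (hf : MemLp f 2 (volume.restrict (cyl Ωs T))) (c : ℝ) (β : EuclideanSpace ℝ (Fin d)) :
    ∫ p in cyl Ωs T, f p * (v p + c * streamDeriv Ωs T β v p)
      = ⟪hf.toLp f, hv.val⟫ + c * ⟪hf.toLp f, hv.stream β⟫ := by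
  rw [MemH1.val, MemH1.stream, inner_toLp, inner_toLp, ← integral_const_mul,
    ← integral_add (integrable_mul_of_memLp hf hv.1)
      ((integrable_mul_of_memLp hf (hv.memLp_streamDeriv β)).const_mul c)]
  exact integral_congr_ae (Eventually.of_forall fun p => by ring)

/-- The equation as an identity in L². This is the consistency of the stabilization: `f` tested with
the streamline derivative equals Lu tested with it. -/
lemma IsWeakSolution.load_eq (hΩo : IsOpen Ωs) (hΩb : Bornology.IsBounded Ωs)
    (h𝒯 : IsTessellation Ωs T σ h 𝒯) {α γ : ℝ} (hα : 0 < α) {β : EuclideanSpace ℝ (Fin d)}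
    {f u : SpaceTime d → ℝ} (hf : MemLp f 2 (volume.restrict (cyl Ωs T)))
    (hu : IsWeakSolution Ωs T α β γ f u)
    (hl : IsBrokenLaplacian Ωs T 𝒯 u (brokenLaplacian Ωs T 𝒯 u)) :
    hf.toLp f = hu.1.1.stream β - α • hl.lap + γ • hu.1.1.val := by
  rw [MemH1.stream, IsBrokenLaplacian.lap, MemH1.val, ← MemLp.toLp_const_smul,
    ← MemLp.toLp_const_smul, ← MemLp.toLp_sub, ← MemLp.toLp_add]
  refine MemLp.toLp_congr _ _ ?_
  filter_upwards [hl.ae_eq h𝒯 (hu.isBrokenLaplacian hΩo hΩb h𝒯 hα hf)] with p hp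
  simp only [Pi.add_apply, Pi.sub_apply, Pi.smul_apply, smul_eq_mul, hp]
  field_simp
  ring

lemma nu_pos (β : EuclideanSpace ℝ (Fin d)) : 0 < nu β := by
  rw [nu]
  positivity

lemma nu_le_one (β : EuclideanSpace ℝ (Fin d)) : nu β ≤ 1 := by
  rw [nu]
  refine div_le_one_of_le₀ (Real.one_le_sqrt.2 ?_) (Real.sqrt_nonneg _)
  linarith [sq_nonneg ‖β‖]

end StreamlineDiffusion

/-! ### The error estimate -/

open StreamlineDiffusion RealInnerProductSpace in
theorem theorem2 (d : ℕ) (Ωs : Set (EuclideanSpace ℝ (Fin d))) (hΩo : IsOpen Ωs)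
    (hΩb : Bornology.IsBounded Ωs) (hΩn : Ωs.Nonempty) (T : ℝ) (hT : 0 < T)
    (r : ℕ) (hr : 1 < r) (σ : ℝ) (hσ : 0 < σ) (M : ℝ) :
    ∃ θ₀ : ℝ, 0 < θ₀ ∧ ∀ θ : ℝ, 0 < θ → θ ≤ θ₀ → ∃ C : ℝ, 0 < C ∧
      ∀ (α : ℝ) (β : EuclideanSpace ℝ (Fin d)) (γ : ℝ),
        0 < α → α ≤ M → 0 ≤ γ → γ ≤ M →
      ∀ (h : ℝ) (𝒯 : Set (Set (StreamlineDiffusion.SpaceTime d))), 0 < h →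
        StreamlineDiffusion.IsTessellation Ωs T σ h 𝒯 →
      ∀ f u uh : StreamlineDiffusion.SpaceTime d → ℝ,
        MemLp f 2 (volume.restrict (StreamlineDiffusion.cyl Ωs T)) →
        StreamlineDiffusion.IsWeakSolution Ωs T α β γ f u →
        StreamlineDiffusion.IsDiscreteSolution Ωs T 𝒯 r h θ α β γ f uh →
        StreamlineDiffusion.energySq Ωs T h α β γ (fun p => u p - uh p) ≤
          C * ⨅ χ : ↥(StreamlineDiffusion.FESpace Ωs T 𝒯 r),
            (StreamlineDiffusion.energySq Ωs T h α β γ (fun p => u p - χ.1 p)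
              + ∫ p in StreamlineDiffusion.cyl Ωs T,
                  ((h ^ 2 * StreamlineDiffusion.nu β)⁻¹ * (u p - χ.1 p) ^ 2
                    + α * h ^ 2 * StreamlineDiffusion.brokenLaplacian Ωs T 𝒯
                        (fun q => u q - χ.1 q) p ^ 2)) := by
  obtain ⟨CI, hCI0, hCI⟩ := exists_inverse_estimate_FESpace d r hσ
  -- Chosen so that 8θM·CI ≤ 1. The sign of `M` is unknown until α is given, hence the absolute
  -- value, and the added 1 covers the case where the product is zero.
  refine ⟨(8 * |M| * CI + 1)⁻¹, by positivity, fun θ hθ hθ0 => ?_⟩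
  set R := (σ * T) ^ 2 with hR
  refine ⟨2 + (8 + 6 / θ) * (2 + 2 / θ + 2 * θ + 2 * θ * |M| + 2 * θ * R * |M|), by positivity, ?_⟩
  intro α β γ hα hαM hγ hγM h 𝒯 hh h𝒯 f u uh hf hu huh
  have hM : |M| = M := abs_of_pos (hα.trans_le hαM)
  rw [hM] at hθ0 ⊢
  have hMpos : 0 < M := hα.trans_le hαM
  -- Needed for the real infimum: a lower bound for every χ bounds it only over a nonempty index
  -- set.
  have : Nonempty ↥(FESpace Ωs T 𝒯 r) := ⟨⟨uh, huh.1⟩⟩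
  rw [Real.mul_iInf_of_nonneg (by positivity)]
  refine le_ciInf fun ⟨χ, hχ⟩ => ?_
  have hθM : 8 * θ * M * CI ≤ 1 := by
    have h1 := mul_le_mul_of_nonneg_right hθ0 (by positivity : 0 ≤ 8 * M * CI + 1)
    rw [inv_mul_cancel₀ (by positivity)] at h1
    linarith
  have hν := nu_pos β
  have hν1 := nu_le_one β
  have hδ : 0 < h ^ 2 * nu β := by positivity
  have hδh : h ^ 2 * nu β ≤ h ^ 2 := mul_le_of_le_one_right (by positivity) hν1
  have hδR : h ^ 2 * nu β ≤ R :=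
    hδh.trans (pow_le_pow_left₀ hh.le (h𝒯.size_lt hΩn hT hσ hh).le 2)
  have hu1 := hu.1
  have huh1 := huh.1.2.1
  have hχ1 := hχ.2.1
  have hη := hu1.sub hΩo hχ1
  have he := hu1.sub hΩo huh1
  have hξ := hχ1.sub hΩo huh1
  have hξV := sub_mem_FESpace hΩo hχ huh.1
  have lu := (hu.isBrokenLaplacian hΩo hΩb h𝒯 hα hf).spec
  have luh := (exists_isBrokenLaplacian_of_mem_FESpace h𝒯 huh.1).choose_spec.spec
  have lχ := (exists_isBrokenLaplacian_of_mem_FESpace h𝒯 hχ).choose_spec.spec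
  have lη := (lu.sub h𝒯 hu1.1.1 hχ1.1.1 lχ).spec
  have lξ := (lχ.sub h𝒯 hχ1.1.1 huh1.1.1 luh).spec
  have hweak := hu.2 _ hξ
  -- Stabilization weight 0 gives the plain load functional of the weak problem.
  have hload := integral_load_eq hξ.1 hf 0 β
  simp only [zero_mul, add_zero] at hload
  rw [formB_eq hu1.1 hξ.1, hload] at hweak
  have hdisc := huh.2 _ hξV
  rw [formB_eq huh1.1 hξ.1, integral_opL_eq huh1.1 hξ.1 luh, integral_load_eq hξ.1 hf] at hdisc
  have hF := hu.load_eq hΩo hΩb h𝒯 hα hf lu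
  rw [energySq_eq hΩo hΩb hT he, energySq_eq hΩo hΩb hT hη, integral_weighted_sq_eq hη.1 lη]
  have hinv := hCI Ωs T h 𝒯 hh h𝒯 _ hξV
  have hinv' : h ^ 2 * ‖lξ.lap‖ ^ 2 ≤ CI * ‖hξ.1.grad‖ ^ 2 := by
    rw [IsBrokenLaplacian.lap, norm_toLp_sq, ← real_inner_self_eq_norm_sq, hξ.1.inner_grad hξ.1,
      integral_finsetSum _ fun i _ => integrable_mul_of_memLp (hξ.1.hasWeakDeriv_ex i).1
        (hξ.1.hasWeakDeriv_ex i).1]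
    simpa only [pow_two] using hinv
  -- η − (u_h − u) = 2η + ξ, written with differences only so that closure of H¹_E under subtraction
  -- suffices.
  have hpos := (hη.sub hΩo (huh1.sub hΩo hu1)).inner_stream_nonneg hΩo hΩb hT β
  have hneg := (hη.sub hΩo hξ).inner_stream_nonneg hΩo hΩb hT β
  have hax := hη.inner_stream_nonneg hΩo hΩb hT β
  have hby := hξ.inner_stream_nonneg hΩo hΩb hT β
  have vη := hu1.1.val_sub hχ1.1
  have vξ := hχ1.1.val_sub huh1.1
  have ve := hu1.1.val_sub huh1.1
  have sη := hu1.1.stream_sub hΩo hχ1.1 β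
  have sξ := hχ1.1.stream_sub hΩo huh1.1 β
  have se := hu1.1.stream_sub hΩo huh1.1 β
  have gη := hu1.1.grad_sub hΩo hχ1.1
  have gξ := hχ1.1.grad_sub hΩo huh1.1
  have ge := hu1.1.grad_sub hΩo huh1.1
  have mη := IsBrokenLaplacian.lap_sub h𝒯 hu1.1 hχ1.1 lu lχ
  have mξ := IsBrokenLaplacian.lap_sub h𝒯 hχ1.1 huh1.1 lχ luh
  have ve' : he.1.val = hη.1.val + hξ.1.val := by rw [ve, vη, vξ]; abel
  have se' : he.1.stream β = hη.1.stream β + hξ.1.stream β := by rw [se, sη, sξ]; abel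
  have ge' : he.1.grad = hη.1.grad + hξ.1.grad := by rw [ge, gη, gξ]; abel
  have me' : lu.lap - luh.lap = lη.lap + lξ.lap := by rw [mη, mξ]; abel
  rw [ve', se', ge']
  refine stream_stability hα hαM hγ hγM hδ hδh hδR hθ hθM ?_ hby hax ?_ ?_ hinv'
  -- Galerkin orthogonality: with f replaced by Lu, subtracting the discrete equation from the weak
  -- one, both tested with ξ, leaves the stabilized form of u − u_h equal to zero.
  · rw [← ve', ← se', ← ge', ← me', ve, se, ge]
    rw [hF] at hweak hdisc
    simp only [inner_add_left, inner_sub_left, real_inner_smul_left, smul_sub] at hweak hdisc ⊢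
    linarith
  · have sp : (hη.sub hΩo (huh1.sub hΩo hu1)).1.stream β
        = hη.1.stream β + hη.1.stream β + hξ.1.stream β := by
      rw [MemH1.stream_sub hΩo hη.1 (huh1.sub hΩo hu1).1, huh1.1.stream_sub hΩo hu1.1, sη, sξ]
      abel
    have vp : (hη.sub hΩo (huh1.sub hΩo hu1)).1.val = hη.1.val + hη.1.val + hξ.1.val := by
      rw [MemH1.val_sub hη.1 (huh1.sub hΩo hu1).1, huh1.1.val_sub hu1.1, vη, vξ]
      abel
    rwa [sp, vp] at hpos
  · rwa [MemH1.stream_sub hΩo hη.1 hξ.1, MemH1.val_sub hη.1 hξ.1] at hneg
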